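/- **Conventions.** A variety is a complex quasi-projective variety (reduced, possibly reducible, disconnected or empty). A $G$-variety, for a finite group $G$, is a variety with a left action of $G$ by regular automorphisms; we also write $(Z,G)$ for a $G$-variety $Z$. An isomorphism $(Z,G)\cong(Z',G')$ consists of a group isomorphism $\varphi:G\to G'$ and an isomorphism of varieties $\psi:Z\to Z'$ with $\psi(gx)=\varphi(g)\psi(x)$. A *variety with a finite groups action* is a finite disjoint union $\mathcal X=\bigsqcup_{i}(X_i,G_i)$ of $G_i$-varieties $X_i$ for finite groups $G_i$. A partition of $\mathcal X$ is a decomposition of the components $X_i$ into finitely many $G_i$-invariant locally closed subvarieties; $\mathcal X$ and $\mathcal Y$ are *equivalent* if they have partitions into the same number of pairwise isomorphic pieces. For an embedding $\varphi:G\to H$ of finite groups and a $G$-variety $Z$, the induced $H$-variety ${\rm ind}_G^H Z$ is $(H\times Z)/\sim$, where $(h_1,x_1)\sim(h_2,x_2)$ if there is $g\in G$ with $h_2=h_1\varphi(g)^{-1}$ and $x_2=gx_1$; it is a disjoint union of copies of $Z$ indexed by $H/\varphi(G)$, and $H$ acts by left multiplication on the first component. The Grothendieck ring $K_0^{\rm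 fGr}({\rm Var}_{\mathbb C})$ is the abelian group generated by the classes $[\mathcal X]$ of varieties with finite groups actions modulo the relations: 1. $[\mathcal X]=[\mathcal Y]$ if $\mathcal X$ and $\mathcal Y$ are equivalent; 2. $[\mathcal X]=[\mathcal Y]+[\mathcal X\setminus\mathcal Y]$ if $\mathcal Y\subset\mathcal X$ is a Zariski closed subvariety invariant under the groups actions; 3. $[({\rm ind}_G^H Z,H)]=[(Z,G)]$ for every embedding $G\to H$ of finite groups and every $G$-variety $Z$. The multiplication is given by the Cartesian product, $[(Z_1,G_1)]\cdot[(Z_2,G_2)]=[(Z_1\times Z_2,G_1\times G_2)]$, and the unit is the class of a point with the action of the trivial group. For a $G$-variety $Z$ let $G_n=G^n\rtimes S_n$ be the wreath product, acting on $Z^n$ ($G^n$ componentwise, $S_n$ by permuting the components). The Kapranov zeta function of $(Z,G)$ is $$\zeta_{(Z,G)}(t)=1+\sum_{n\ge1}[(Z^n,G_n)]\,t^n\in 1+t\,K_0^{\rm fGr}({\rm Var}_{\mathbb C})[[t]].$$ A *$\lambda$-structure* on a commutative ring $R$ is a map $R\to 1+tR[[t]]$, $a\mapsto\lambda_a(t)$,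 such that $\lambda_{a+b}(t)=\lambda_a(t)\lambda_b(t)$ and $\lambda_a(t)=1+at+\cdots$ for all $a,b\in R$. **Statement.** (i) For every embedding $G\to H$ of finite groups and every $G$-variety $Z$, $\zeta_{({\rm ind}_G^H Z,H)}(t)=\zeta_{(Z,G)}(t)$. (ii) For every finite group $G$ and all $G$-varieties $Z_1,Z_2$, $\zeta_{(Z_1\sqcup Z_2,G)}(t)=\zeta_{(Z_1,G)}(t)\cdot\zeta_{(Z_2,G)}(t)$. (iii) The Kapranov zeta function is well defined on $K_0^{\rm fGr}({\rm Var}_{\mathbb C})$ and defines a $\lambda$-structure on this ring: there is exactly one $\lambda$-structure $a\mapsto\lambda_a(t)$ on $K_0^{\rm fGr}({\rm Var}_{\mathbb C})$ such that $\lambda_{[(Z,G)]}(t)=\zeta_{(Z,G)}(t)$ for every finite group $G$ and every $G$-variety $Z$. -/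

import Mathlib

open scoped LinearAlgebra.Projectivization Topology

namespace FGr

/-! ### Complex quasi-projective varieties -/

/-- The complex projective space with homogeneous coordinates indexed by `σ`
(of dimension `card σ - 1` when `σ` is finite). -/
abbrev Proj (σ : Type) : Type := ℙ ℂ (σ → ℂ)

/-- `v` is a vector of homogeneous coordinates of the point `x`. -/
def IsCoord {σ : Type} (x : Proj σ) (v : σ → ℂ) : Prop :=
  ∃ h : v ≠ 0, Projectivization.mk ℂ v h = x

/-- The set of points where the form `p` does not vanish. -/
def basicOpen {σ : Type} (p : MvPolynomial σ ℂ) : Set (Proj σ) :=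
  {x | ∃ v, IsCoord x v ∧ MvPolynomial.eval v p ≠ 0}

/-- The Zariski topology: the open sets are the unions of the nonvanishing loci of
homogeneous polynomials. -/
instance zariski (σ : Type) : TopologicalSpace (Proj σ) :=
  TopologicalSpace.generateFrom {U | ∃ p d, MvPolynomial.IsHomogeneous p d ∧ U = basicOpen p}

/-- The structure of a complex quasi-projective variety on the set `A`: an identification of `A`
with a Zariski locally closed subset of a projective space. (Varieties are reduced, need not be
irreducible or connected, and may be empty.) -/
structure QProjStr (A : Type) where
  σ : Type
  finite_σ : Finite σ
  emb : A → Proj σ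
  emb_injective : Function.Injective emb
  isLocallyClosed_range : IsLocallyClosed (Set.range emb)

/-- The Zariski topology of a quasi-projective variety. -/
@[reducible] def QProjStr.top {A : Type} (S : QProjStr A) : TopologicalSpace A :=
  TopologicalSpace.induced S.emb (zariski S.σ)

/-- `s` is Zariski open. -/
def QProjStr.IsOpen {A : Type} (S : QProjStr A) (s : Set A) : Prop := IsOpen[S.top] s

/-- `s` is Zariski closed. -/
def QProjStr.IsClosed {A : Type} (S : QProjStr A) (s : Set A) : Prop := IsClosed[S.top] s

/-- `s` is Zariski locally closed. -/
def QProjStr.IsLocallyClosed {A : Type} (S : QProjStr A) (s : Set A) : Prop :=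
  @_root_.IsLocallyClosed A S.top s

/-- Regular maps between quasi-projective varieties: maps which near each point are given, in
homogeneous coordinates, by forms of the same degree without a common zero. -/
def IsRegular {A B : Type} (S : QProjStr A) (T : QProjStr B) (f : A → B) : Prop :=
  ∀ a : A, ∃ U : Set A, S.IsOpen U ∧ a ∈ U ∧
    ∃ (d : ℕ) (F : T.σ → MvPolynomial S.σ ℂ), (∀ j, (F j).IsHomogeneous d) ∧
      ∀ b ∈ U, ∀ v, IsCoord (S.emb b) v →
        IsCoord (T.emb (f b)) (fun j => MvPolynomial.eval v (F j))

/-! Homogeneous coordinates and the Zariski topology: basic facts. -/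

section coord
variable {σ τ : Type}

lemma isCoord_rep (x : Proj σ) : IsCoord x x.rep := ⟨x.rep_nonzero, x.mk_rep⟩

lemma isCoord_mk {v : σ → ℂ} (h : v ≠ 0) : IsCoord (Projectivization.mk ℂ v h) v := ⟨h, rfl⟩

lemma IsCoord.ext {x y : Proj σ} {v : σ → ℂ} (h : IsCoord x v) (k : IsCoord y v) : x = y := by
  obtain ⟨_, rfl⟩ := h
  obtain ⟨_, rfl⟩ := k
  rfl

lemma IsCoord.smul {x : Proj σ} {v : σ → ℂ} (h : IsCoord x v) {c : ℂ} (hc : c ≠ 0) :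
    IsCoord x (c • v) := by
  obtain ⟨h0, rfl⟩ := h
  refine ⟨smul_ne_zero hc h0, ?_⟩
  rw [Projectivization.mk_eq_mk_iff']
  exact ⟨c, rfl⟩

lemma IsCoord.eq_smul {x : Proj σ} {v w : σ → ℂ} (h : IsCoord x v) (k : IsCoord x w) :
    ∃ c : ℂ, c ≠ 0 ∧ v = c • w := by
  obtain ⟨h0, rfl⟩ := h
  obtain ⟨k0, k⟩ := k
  rw [Projectivization.mk_eq_mk_iff'] at k
  obtain ⟨a, ha⟩ := k
  have ha0 : a ≠ 0 := by rintro rfl; exact k0 (by rw [← ha, zero_smul])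
  exact ⟨a⁻¹, inv_ne_zero ha0, by rw [← ha, smul_smul, inv_mul_cancel₀ ha0, one_smul]⟩

lemma eval_smul_of_homogeneous {p : MvPolynomial σ ℂ} {d : ℕ} (hp : p.IsHomogeneous d) (c : ℂ)
    (v : σ → ℂ) : MvPolynomial.eval (c • v) p = c ^ d * MvPolynomial.eval v p := by
  rw [MvPolynomial.eval_eq, MvPolynomial.eval_eq, Finset.mul_sum]
  refine Finset.sum_congr rfl fun m hm => ?_
  have h1 := hp.degree_eq_sum_deg_support hm
  simp only [Pi.smul_apply, smul_eq_mul, mul_pow, Finset.prod_mul_distrib]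
  rw [Finset.prod_pow_eq_pow_sum, ← h1]
  ring

lemma eval_aeval (v : τ → ℂ) (F : σ → MvPolynomial τ ℂ) (p : MvPolynomial σ ℂ) :
    MvPolynomial.eval v (MvPolynomial.aeval F p) =
      MvPolynomial.eval (fun j => MvPolynomial.eval v (F j)) p := by
  induction p using MvPolynomial.induction_on with
  | C a => simp
  | add p q hp hq => rw [map_add, map_add, map_add, hp, hq]
  | mul_X p i hp => rw [map_mul, map_mul, map_mul, hp, MvPolynomial.aeval_X, MvPolynomial.eval_X]

lemma mem_basicOpen {p : MvPolynomial σ ℂ} {d : ℕ} (hp : p.IsHomogeneous d) {x : Proj σ}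
    {v : σ → ℂ} (h : IsCoord x v) : x ∈ basicOpen p ↔ MvPolynomial.eval v p ≠ 0 := by
  refine ⟨?_, fun k => ⟨v, h, k⟩⟩
  rintro ⟨w, hw, k⟩
  obtain ⟨c, hc, rfl⟩ := hw.eq_smul h
  rw [eval_smul_of_homogeneous hp] at k
  exact (mul_ne_zero_iff.1 k).2

lemma isOpen_basicOpen {p : MvPolynomial σ ℂ} {d : ℕ} (hp : p.IsHomogeneous d) :
    IsOpen (basicOpen p) :=
  TopologicalSpace.isOpen_generateFrom_of_mem ⟨p, d, hp, rfl⟩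

/-- A set cut out by a family of forms is Zariski closed. -/
lemma isClosed_of_forms {ι : Type} (p : ι → MvPolynomial σ ℂ) (d : ι → ℕ)
    (hp : ∀ i, (p i).IsHomogeneous (d i)) (s : Set (Proj σ))
    (hs : ∀ x v, IsCoord x v → (x ∈ s ↔ ∀ i, MvPolynomial.eval v (p i) = 0)) : IsClosed s := by
  have : s = ⋂ i, (basicOpen (p i))ᶜ := by
    ext x
    simp only [hs x _ (isCoord_rep x), Set.mem_iInter, Set.mem_compl_iff,
      mem_basicOpen (hp _) (isCoord_rep x), not_not]
  rw [this]
  exact isClosed_iInter fun i => (isOpen_basicOpen (hp i)).isClosed_compl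

/-! ### The Segre embedding -/

lemma segre_ne_zero {v : σ → ℂ} {w : τ → ℂ} (hv : v ≠ 0) (hw : w ≠ 0) :
    (fun k : σ × τ => v k.1 * w k.2) ≠ 0 := by
  obtain ⟨s, hs⟩ := Function.ne_iff.1 hv
  obtain ⟨t, ht⟩ := Function.ne_iff.1 hw
  exact Function.ne_iff.2 ⟨(s, t), mul_ne_zero hs ht⟩

/-- The Segre map, `((xₛ)ₛ, (yₜ)ₜ) ↦ (xₛ yₜ)ₛₜ` in homogeneous coordinates. -/
noncomputable def segre (x : Proj σ × Proj τ) : Proj (σ × τ) :=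
  Projectivization.mk ℂ (fun k : σ × τ => x.1.rep k.1 * x.2.rep k.2)
    (segre_ne_zero x.1.rep_nonzero x.2.rep_nonzero)

lemma IsCoord.segre {x : Proj σ} {y : Proj τ} {v : σ → ℂ} {w : τ → ℂ} (h : IsCoord x v)
    (k : IsCoord y w) : IsCoord (segre (x, y)) (fun k : σ × τ => v k.1 * w k.2) := by
  obtain ⟨a, ha, rfl⟩ := h.eq_smul (isCoord_rep x)
  obtain ⟨b, hb, rfl⟩ := k.eq_smul (isCoord_rep y)
  have h1 : IsCoord (FGr.segre (x, y)) _ := isCoord_mk _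
  convert h1.smul (mul_ne_zero ha hb) using 1
  funext k
  simp only [Pi.smul_apply, smul_eq_mul]
  ring

/-- Coordinates of the first factor from those of the Segre image. -/
lemma isCoord_fst {x : Proj σ × Proj τ} {u : σ × τ → ℂ} (h : IsCoord (segre x) u) {t : τ}
    (ht : ∃ s, u (s, t) ≠ 0) : IsCoord x.1 (fun s => u (s, t)) := by
  obtain ⟨c, hc, rfl⟩ := h.eq_smul ((isCoord_rep x.1).segre (isCoord_rep x.2))
  obtain ⟨s, hs⟩ := ht
  simp only [Pi.smul_apply, smul_eq_mul] at hs
  have h2 : x.2.rep t ≠ 0 := by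
    intro h0
    simp [h0] at hs
  convert (isCoord_rep x.1).smul (mul_ne_zero hc h2) using 1
  funext k
  simp only [Pi.smul_apply, smul_eq_mul]
  ring

lemma isCoord_snd {x : Proj σ × Proj τ} {u : σ × τ → ℂ} (h : IsCoord (segre x) u) {s : σ}
    (hs : ∃ t, u (s, t) ≠ 0) : IsCoord x.2 (fun t => u (s, t)) := by
  obtain ⟨c, hc, rfl⟩ := h.eq_smul ((isCoord_rep x.1).segre (isCoord_rep x.2))
  obtain ⟨t, ht⟩ := hs
  simp only [Pi.smul_apply, smul_eq_mul] at ht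
  have h2 : x.1.rep s ≠ 0 := by
    intro h0
    simp [h0] at ht
  convert (isCoord_rep x.2).smul (mul_ne_zero hc h2) using 1
  funext k
  simp only [Pi.smul_apply, smul_eq_mul]
  ring

lemma segre_injective : Function.Injective (segre : Proj σ × Proj τ → Proj (σ × τ)) := by
  intro x y hxy
  have hx : IsCoord (segre x) _ := isCoord_rep _
  have hy : IsCoord (segre y) (segre x).rep := hxy ▸ hx
  obtain ⟨⟨s, t⟩, h⟩ := Function.ne_iff.1 (segre x).rep_nonzero
  exact Prod.ext ((isCoord_fst hx ⟨s, h⟩).ext (isCoord_fst hy ⟨s, h⟩))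
    ((isCoord_snd hx ⟨t, h⟩).ext (isCoord_snd hy ⟨t, h⟩))

lemma isClosed_range_segre : IsClosed (Set.range (segre : Proj σ × Proj τ → Proj (σ × τ))) := by
  refine isClosed_of_forms (ι := (σ × τ) × (σ × τ))
    (fun k => MvPolynomial.X k.1 * MvPolynomial.X k.2 -
      MvPolynomial.X (k.1.1, k.2.2) * MvPolynomial.X (k.2.1, k.1.2)) (fun _ => 1 + 1)
    (fun k => ((MvPolynomial.isHomogeneous_X _ _).mul (MvPolynomial.isHomogeneous_X _ _)).sub
      ((MvPolynomial.isHomogeneous_X _ _).mul (MvPolynomial.isHomogeneous_X _ _))) _ ?_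
  intro x u hu
  simp only [map_sub, map_mul, MvPolynomial.eval_X]
  constructor
  · rintro ⟨⟨y, z⟩, rfl⟩ ⟨⟨s, t⟩, ⟨s', t'⟩⟩
    obtain ⟨c, hc, rfl⟩ := hu.eq_smul ((isCoord_rep y).segre (isCoord_rep z))
    simp only [Pi.smul_apply, smul_eq_mul]
    ring
  · intro h
    obtain ⟨⟨s, t⟩, h0⟩ := Function.ne_iff.1 hu.choose
    have hv : (fun a => u (a, t)) ≠ 0 := Function.ne_iff.2 ⟨s, h0⟩
    have hw : (fun b => u (s, b)) ≠ 0 := Function.ne_iff.2 ⟨t, h0⟩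
    refine ⟨(Projectivization.mk ℂ _ hv, Projectivization.mk ℂ _ hw), ?_⟩
    refine ((isCoord_mk hv).segre (isCoord_mk hw)).ext ?_
    convert hu.smul h0 using 1
    funext ⟨a, b⟩
    have := h ((a, t), (s, b))
    simp only [Pi.smul_apply, smul_eq_mul]
    linear_combination this

lemma isOpen_fst_preimage {U : Set (Proj σ)} (hU : IsOpen U) :
    IsOpen[TopologicalSpace.induced (segre : Proj σ × Proj τ → _) (zariski _)]
      (Prod.fst ⁻¹' U : Set (Proj σ × Proj τ)) := by
  let _ : TopologicalSpace (Proj σ × Proj τ) := TopologicalSpace.induced segre (zariski _)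
  have : Continuous (Prod.fst : Proj σ × Proj τ → Proj σ) := by
    refine continuous_generateFrom_iff.2 ?_
    rintro _ ⟨p, d, hp, rfl⟩
    have : (Prod.fst ⁻¹' basicOpen p : Set (Proj σ × Proj τ)) =
        ⋃ t : τ, segre ⁻¹' basicOpen (MvPolynomial.rename (fun s => (s, t)) p) := by
      ext x
      have hx := (isCoord_rep x.1).segre (isCoord_rep x.2)
      have key : ∀ t, MvPolynomial.eval (fun k : σ × τ => x.1.rep k.1 * x.2.rep k.2)
          (MvPolynomial.rename (fun s => (s, t)) p) =
          x.2.rep t ^ d * MvPolynomial.eval x.1.rep p := by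
        intro t
        rw [MvPolynomial.eval_rename, ← eval_smul_of_homogeneous hp]
        congr 2
        funext s
        simp [mul_comm]
      simp only [Set.mem_preimage, Set.mem_iUnion, mem_basicOpen hp (isCoord_rep x.1),
        mem_basicOpen (MvPolynomial.IsHomogeneous.rename_isHomogeneous hp) hx, key]
      constructor
      · intro h
        obtain ⟨t, ht⟩ := Function.ne_iff.1 x.2.rep_nonzero
        exact ⟨t, mul_ne_zero (pow_ne_zero _ ht) h⟩
      · rintro ⟨t, ht⟩
        exact (mul_ne_zero_iff.1 ht).2
    rw [this]
    exact isOpen_iUnion fun t => (isOpen_basicOpen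
      (MvPolynomial.IsHomogeneous.rename_isHomogeneous hp)).preimage continuous_induced_dom
  exact hU.preimage this

lemma isOpen_snd_preimage {U : Set (Proj τ)} (hU : IsOpen U) :
    IsOpen[TopologicalSpace.induced (segre : Proj σ × Proj τ → _) (zariski _)]
      (Prod.snd ⁻¹' U : Set (Proj σ × Proj τ)) := by
  let _ : TopologicalSpace (Proj σ × Proj τ) := TopologicalSpace.induced segre (zariski _)
  have : Continuous (Prod.snd : Proj σ × Proj τ → Proj τ) := by
    refine continuous_generateFrom_iff.2 ?_
    rintro _ ⟨p, d, hp, rfl⟩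
    have : (Prod.snd ⁻¹' basicOpen p : Set (Proj σ × Proj τ)) =
        ⋃ s : σ, segre ⁻¹' basicOpen (MvPolynomial.rename (fun t => (s, t)) p) := by
      ext x
      have hx := (isCoord_rep x.1).segre (isCoord_rep x.2)
      have key : ∀ s, MvPolynomial.eval (fun k : σ × τ => x.1.rep k.1 * x.2.rep k.2)
          (MvPolynomial.rename (fun t => (s, t)) p) =
          x.1.rep s ^ d * MvPolynomial.eval x.2.rep p := by
        intro s
        rw [MvPolynomial.eval_rename, ← eval_smul_of_homogeneous hp]
        rfl
      simp only [Set.mem_preimage, Set.mem_iUnion, mem_basicOpen hp (isCoord_rep x.2),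
        mem_basicOpen (MvPolynomial.IsHomogeneous.rename_isHomogeneous hp) hx, key]
      constructor
      · intro h
        obtain ⟨t, ht⟩ := Function.ne_iff.1 x.1.rep_nonzero
        exact ⟨t, mul_ne_zero (pow_ne_zero _ ht) h⟩
      · rintro ⟨t, ht⟩
        exact (mul_ne_zero_iff.1 ht).2
    rw [this]
    exact isOpen_iUnion fun t => (isOpen_basicOpen
      (MvPolynomial.IsHomogeneous.rename_isHomogeneous hp)).preimage continuous_induced_dom
  exact hU.preimage this

lemma isLocallyClosed_segre {s : Set (Proj σ)} {t : Set (Proj τ)} (hs : IsLocallyClosed s)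
    (ht : IsLocallyClosed t) : IsLocallyClosed (segre '' (s ×ˢ t)) := by
  let _ : TopologicalSpace (Proj σ × Proj τ) := TopologicalSpace.induced segre (zariski _)
  have h1 : Continuous (Prod.fst : Proj σ × Proj τ → Proj σ) :=
    ⟨fun U hU => isOpen_fst_preimage hU⟩
  have h2 : Continuous (Prod.snd : Proj σ × Proj τ → Proj τ) :=
    ⟨fun U hU => isOpen_snd_preimage hU⟩
  exact ((hs.preimage h1).inter (ht.preimage h2)).image ⟨rfl⟩ isClosed_range_segre.isLocallyClosed

/-! ### Disjoint linear subspaces -/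

lemma elim_left_ne_zero {v : σ → ℂ} (hv : v ≠ 0) : (Sum.elim v 0 : σ ⊕ τ → ℂ) ≠ 0 := by
  obtain ⟨s, hs⟩ := Function.ne_iff.1 hv
  exact Function.ne_iff.2 ⟨Sum.inl s, hs⟩

lemma elim_right_ne_zero {w : τ → ℂ} (hw : w ≠ 0) : (Sum.elim 0 w : σ ⊕ τ → ℂ) ≠ 0 := by
  obtain ⟨s, hs⟩ := Function.ne_iff.1 hw
  exact Function.ne_iff.2 ⟨Sum.inr s, hs⟩

/-- The inclusion of the linear subspace where the coordinates in `τ` vanish. -/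
noncomputable def linl (τ : Type) (x : Proj σ) : Proj (σ ⊕ τ) :=
  Projectivization.mk ℂ (Sum.elim x.rep 0) (elim_left_ne_zero x.rep_nonzero)

/-- The inclusion of the linear subspace where the coordinates in `σ` vanish. -/
noncomputable def linr (σ : Type) (y : Proj τ) : Proj (σ ⊕ τ) :=
  Projectivization.mk ℂ (Sum.elim 0 y.rep) (elim_right_ne_zero y.rep_nonzero)

lemma IsCoord.linl {x : Proj σ} {v : σ → ℂ} (h : IsCoord x v) :
    IsCoord (linl τ x) (Sum.elim v 0) := by
  obtain ⟨a, ha, rfl⟩ := h.eq_smul (isCoord_rep x)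
  have h1 : IsCoord (FGr.linl τ x) _ := isCoord_mk _
  convert h1.smul ha using 1
  funext k
  cases k <;> simp

lemma IsCoord.linr {y : Proj τ} {v : τ → ℂ} (h : IsCoord y v) :
    IsCoord (linr σ y) (Sum.elim 0 v) := by
  obtain ⟨a, ha, rfl⟩ := h.eq_smul (isCoord_rep y)
  have h1 : IsCoord (FGr.linr σ y) _ := isCoord_mk _
  convert h1.smul ha using 1
  funext k
  cases k <;> simp

lemma isCoord_of_linl {x : Proj σ} {u : σ ⊕ τ → ℂ} (h : IsCoord (linl τ x) u) :
    IsCoord x (fun s => u (Sum.inl s)) ∧ ∀ t, u (Sum.inr t) = 0 := by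
  obtain ⟨c, hc, rfl⟩ := h.eq_smul (isCoord_rep x).linl
  exact ⟨(isCoord_rep x).smul hc, fun t => by simp⟩

lemma isCoord_of_linr {y : Proj τ} {u : σ ⊕ τ → ℂ} (h : IsCoord (linr σ y) u) :
    IsCoord y (fun t => u (Sum.inr t)) ∧ ∀ s, u (Sum.inl s) = 0 := by
  obtain ⟨c, hc, rfl⟩ := h.eq_smul (isCoord_rep y).linr
  exact ⟨(isCoord_rep y).smul hc, fun t => by simp⟩

lemma linl_injective : Function.Injective (linl τ : Proj σ → _) := by
  intro x y hxy
  exact (isCoord_of_linl (isCoord_rep (linl τ x))).1.ext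
    (isCoord_of_linl (hxy ▸ isCoord_rep (linl τ x))).1

lemma linr_injective : Function.Injective (linr σ : Proj τ → _) := by
  intro x y hxy
  exact (isCoord_of_linr (isCoord_rep (linr σ x))).1.ext
    (isCoord_of_linr (hxy ▸ isCoord_rep (linr σ x))).1

lemma linl_ne_linr (x : Proj σ) (y : Proj τ) : linl τ x ≠ linr σ y := by
  intro h
  have h0 : IsCoord (linr σ y) (linl τ x).rep := by
    rw [← h]
    exact isCoord_rep _
  have h1 := (isCoord_of_linl (isCoord_rep (linl τ x))).1
  have h2 := (isCoord_of_linr h0).2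
  exact h1.choose (funext fun s => h2 s)

lemma isClosed_range_linl : IsClosed (Set.range (linl τ : Proj σ → _)) := by
  refine isClosed_of_forms (ι := τ) (fun t => MvPolynomial.X (Sum.inr t)) (fun _ => 1)
    (fun t => MvPolynomial.isHomogeneous_X _ _) _ ?_
  intro x u hu
  simp only [MvPolynomial.eval_X]
  constructor
  · rintro ⟨y, rfl⟩ t
    exact (isCoord_of_linl hu).2 t
  · intro h
    have hu' : u = Sum.elim (fun s => u (Sum.inl s)) 0 := by
      funext k
      cases k <;> simp [h]
    have h0 : (fun s => u (Sum.inl s)) ≠ 0 := by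
      intro h0
      apply hu.choose
      rw [hu', h0]
      simp
    exact ⟨Projectivization.mk ℂ _ h0, (isCoord_mk h0).linl.ext (hu' ▸ hu)⟩

lemma isClosed_range_linr : IsClosed (Set.range (linr σ : Proj τ → _)) := by
  refine isClosed_of_forms (ι := σ) (fun t => MvPolynomial.X (Sum.inl t)) (fun _ => 1)
    (fun t => MvPolynomial.isHomogeneous_X _ _) _ ?_
  intro x u hu
  simp only [MvPolynomial.eval_X]
  constructor
  · rintro ⟨y, rfl⟩ t
    exact (isCoord_of_linr hu).2 t
  · intro h
    have hu' : u = Sum.elim (0 : σ → ℂ) (fun s => u (Sum.inr s)) := by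
      funext k
      cases k <;> simp [h]
    have h0 : (fun s => u (Sum.inr s)) ≠ 0 := by
      intro h0
      apply hu.choose
      rw [hu', h0]
      simp
    exact ⟨Projectivization.mk ℂ _ h0, (isCoord_mk h0).linr.ext (hu' ▸ hu)⟩

lemma isInducing_linl : Topology.IsInducing (linl τ : Proj σ → _) := by
  refine ⟨le_antisymm ?_ ?_⟩
  · rw [← continuous_iff_le_induced]
    refine continuous_generateFrom_iff.2 ?_
    rintro _ ⟨p, d, hp, rfl⟩
    have hq := hp.aeval (fun k : σ ⊕ τ => Sum.elim MvPolynomial.X (fun _ => 0) k)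
      (n := 1) (S := ℂ) (by
        rintro (s | t)
        · exact MvPolynomial.isHomogeneous_X _ _
        · exact MvPolynomial.isHomogeneous_zero _ _ _)
    convert isOpen_basicOpen hq using 1
    ext x
    rw [Set.mem_preimage, mem_basicOpen hp (isCoord_rep x).linl, mem_basicOpen hq (isCoord_rep x),
      eval_aeval]
    have : (fun i => MvPolynomial.eval x.rep
        (Sum.elim MvPolynomial.X (fun _ => (0 : MvPolynomial σ ℂ)) i)) =
        (Sum.elim x.rep 0 : σ ⊕ τ → ℂ) := by
      funext k
      cases k <;> simp
    rw [this]
  · refine le_generateFrom ?_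
    rintro _ ⟨p, d, hp, rfl⟩
    have hq : (MvPolynomial.rename (Sum.inl : σ → σ ⊕ τ) p).IsHomogeneous d :=
      MvPolynomial.IsHomogeneous.rename_isHomogeneous hp
    refine ⟨_, isOpen_basicOpen hq, ?_⟩
    ext x
    rw [Set.mem_preimage, mem_basicOpen hq (isCoord_rep x).linl, mem_basicOpen hp (isCoord_rep x),
      MvPolynomial.eval_rename]
    rfl

lemma isInducing_linr : Topology.IsInducing (linr σ : Proj τ → _) := by
  refine ⟨le_antisymm ?_ ?_⟩
  · rw [← continuous_iff_le_induced]
    refine continuous_generateFrom_iff.2 ?_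
    rintro _ ⟨p, d, hp, rfl⟩
    have hq := hp.aeval (fun k : σ ⊕ τ => Sum.elim (fun _ => 0) MvPolynomial.X k)
      (n := 1) (S := ℂ) (by
        rintro (s | t)
        · exact MvPolynomial.isHomogeneous_zero _ _ _
        · exact MvPolynomial.isHomogeneous_X _ _)
    convert isOpen_basicOpen hq using 1
    ext x
    rw [Set.mem_preimage, mem_basicOpen hp (isCoord_rep x).linr, mem_basicOpen hq (isCoord_rep x),
      eval_aeval]
    have : (fun i => MvPolynomial.eval x.rep
        (Sum.elim (fun _ => (0 : MvPolynomial τ ℂ)) MvPolynomial.X i)) =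
        (Sum.elim 0 x.rep : σ ⊕ τ → ℂ) := by
      funext k
      cases k <;> simp
    rw [this]
  · refine le_generateFrom ?_
    rintro _ ⟨p, d, hp, rfl⟩
    have hq : (MvPolynomial.rename (Sum.inr : τ → σ ⊕ τ) p).IsHomogeneous d :=
      MvPolynomial.IsHomogeneous.rename_isHomogeneous hp
    refine ⟨_, isOpen_basicOpen hq, ?_⟩
    ext x
    rw [Set.mem_preimage, mem_basicOpen hq (isCoord_rep x).linr, mem_basicOpen hp (isCoord_rep x),
      MvPolynomial.eval_rename]
    rfl

lemma isLocallyClosed_union {X : Type} [TopologicalSpace X] {s t C D : Set X}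
    (hs : IsLocallyClosed s) (ht : IsLocallyClosed t) (hC : IsClosed C) (hD : IsClosed D)
    (hsC : s ⊆ C) (htD : t ⊆ D) (hCD : Disjoint C D) : IsLocallyClosed (s ∪ t) := by
  obtain ⟨U, Z, hU, hZ, rfl⟩ := hs
  obtain ⟨V, W, hV, hW, rfl⟩ := ht
  refine ⟨(U \ D) ∪ (V \ C), (Z ∩ C) ∪ (W ∩ D), (hU.sdiff hD).union (hV.sdiff hC),
    (hZ.inter hC).union (hW.inter hD), ?_⟩
  have h1 : ∀ x, x ∈ C → x ∉ D := fun x a b => Set.disjoint_left.1 hCD a b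
  ext x
  have h2 := @hsC x
  have h3 := @htD x
  have h4 := h1 x
  simp only [Set.mem_union, Set.mem_inter_iff, Set.mem_sdiff] at *
  tauto

/-! ### Coordinate points -/

open Classical in
lemma single_ne_zero (a : σ) : (Pi.single a 1 : σ → ℂ) ≠ 0 :=
  Function.ne_iff.2 ⟨a, by simp⟩

open Classical in
/-- The point all of whose homogeneous coordinates but the `a`-th are zero. -/
noncomputable def coordPoint (a : σ) : Proj σ :=
  Projectivization.mk ℂ (Pi.single a 1) (single_ne_zero a)

open Classical in
lemma isCoord_coordPoint (a : σ) : IsCoord (coordPoint a) (Pi.single a 1) :=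
  isCoord_mk _

lemma coordPoint_mem (a b : σ) : coordPoint b ∈ basicOpen (MvPolynomial.X a) ↔ a = b := by
  classical
  rw [mem_basicOpen (MvPolynomial.isHomogeneous_X _ _) (isCoord_coordPoint b),
    MvPolynomial.eval_X, Pi.single_apply]
  simp

lemma coordPoint_injective : Function.Injective (coordPoint : σ → Proj σ) := fun a b h =>
  (coordPoint_mem a b).1 (h ▸ (coordPoint_mem a a).2 rfl)

lemma isClosed_range_coordPoint : IsClosed (Set.range (coordPoint : σ → Proj σ)) := by
  classical
  refine isClosed_of_forms (ι := {k : σ × σ // k.1 ≠ k.2})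
    (fun k => MvPolynomial.X k.1.1 * MvPolynomial.X k.1.2) (fun _ => 1 + 1)
    (fun k => (MvPolynomial.isHomogeneous_X _ _).mul (MvPolynomial.isHomogeneous_X _ _)) _ ?_
  intro x u hu
  simp only [map_mul, MvPolynomial.eval_X]
  constructor
  · rintro ⟨a, rfl⟩ ⟨⟨s, t⟩, hst⟩
    obtain ⟨c, hc, rfl⟩ := hu.eq_smul (isCoord_coordPoint a)
    simp only [Pi.smul_apply, Pi.single_apply, smul_eq_mul]
    by_cases h1 : s = a
    · have : t ≠ a := fun h => hst (h1.trans h.symm)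
      simp [this]
    · simp [h1]
  · intro h
    obtain ⟨a, ha⟩ := Function.ne_iff.1 hu.choose
    refine ⟨a, ((isCoord_coordPoint a).smul ha).ext ?_⟩
    convert hu using 1
    funext b
    by_cases hb : b = a
    · subst hb
      simp
    · have := h ⟨(a, b), fun h => hb h.symm⟩
      simp only [mul_eq_zero] at this
      simp only [Pi.smul_apply, Pi.single_apply, hb, if_false, smul_zero]
      exact (this.resolve_left ha).symm

end coord

/-! ### Constructions of quasi-projective varieties -/

namespace QProjStr
variable {A B : Type}

lemma isInducing_emb (S : QProjStr A) : @Topology.IsInducing _ _ S.top _ S.emb :=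
  let _ := S.top
  ⟨rfl⟩

/-- The transport of the structure along a bijection. -/
def transport (S : QProjStr A) (e : B ≃ A) : QProjStr B where
  σ := S.σ
  finite_σ := S.finite_σ
  emb := S.emb ∘ e
  emb_injective := S.emb_injective.comp e.injective
  isLocallyClosed_range := by
    rw [EquivLike.range_comp]
    exact S.isLocallyClosed_range

/-- A locally closed subset of a quasi-projective variety is a quasi-projective variety. -/
def restrict (S : QProjStr A) (s : Set A) (hs : S.IsLocallyClosed s) : QProjStr s where
  σ := S.σ
  finite_σ := S.finite_σ
  emb := fun a => S.emb a
  emb_injective := S.emb_injective.comp Subtype.val_injective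
  isLocallyClosed_range := by
    have : Set.range (fun a : s => S.emb a) = S.emb '' s := by
      ext x
      simp
    rw [this]
    let _ := S.top
    exact _root_.IsLocallyClosed.image hs S.isInducing_emb S.isLocallyClosed_range

/-- The product of two quasi-projective varieties, through the Segre embedding. -/
noncomputable def prod (S : QProjStr A) (T : QProjStr B) : QProjStr (A × B) where
  σ := S.σ × T.σ
  finite_σ := by
    have := S.finite_σ
    have := T.finite_σ
    infer_instance
  emb := fun x => segre (S.emb x.1, T.emb x.2)
  emb_injective := fun x y h => by
    have := segre_injective h
    rw [Prod.mk.injEq] at this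
    exact Prod.ext (S.emb_injective this.1) (T.emb_injective this.2)
  isLocallyClosed_range := by
    have : Set.range (fun x : A × B => segre (S.emb x.1, T.emb x.2)) =
        segre '' (Set.range S.emb ×ˢ Set.range T.emb) := by
      rw [Set.prod_range_range_eq, ← Set.range_comp]
      rfl
    rw [this]
    exact isLocallyClosed_segre S.isLocallyClosed_range T.isLocallyClosed_range

/-- The disjoint union of two quasi-projective varieties, each of them placed in one of two
disjoint linear subspaces of a projective space. -/
noncomputable def sum (S : QProjStr A) (T : QProjStr B) : QProjStr (A ⊕ B) where
  σ := S.σ ⊕ T.σ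
  finite_σ := by
    have := S.finite_σ
    have := T.finite_σ
    infer_instance
  emb := Sum.elim (fun a => linl T.σ (S.emb a)) (fun b => linr S.σ (T.emb b))
  emb_injective := by
    rintro (a | a) (b | b) h
    · exact congrArg _ (S.emb_injective (linl_injective h))
    · exact (linl_ne_linr _ _ h).elim
    · exact (linl_ne_linr _ _ h.symm).elim
    · exact congrArg _ (T.emb_injective (linr_injective h))
  isLocallyClosed_range := by
    rw [Set.Sum.elim_range]
    refine isLocallyClosed_union (C := Set.range (linl T.σ)) (D := Set.range (linr S.σ)) ?_ ?_
      isClosed_range_linl isClosed_range_linr ?_ ?_ ?_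
    · have := S.isLocallyClosed_range.image (isInducing_linl (τ := T.σ))
        isClosed_range_linl.isLocallyClosed
      rwa [← Set.range_comp] at this
    · have := T.isLocallyClosed_range.image (isInducing_linr (σ := S.σ))
        isClosed_range_linr.isLocallyClosed
      rwa [← Set.range_comp] at this
    · exact Set.range_comp_subset_range S.emb (linl T.σ)
    · exact Set.range_comp_subset_range T.emb (linr S.σ)
    · rw [Set.disjoint_left]
      rintro _ ⟨x, rfl⟩ ⟨y, h⟩
      exact linl_ne_linr _ _ h.symm

/-- A finite set as a variety of dimension zero. -/
noncomputable def discrete (A : Type) [Finite A] : QProjStr A where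
  σ := A
  finite_σ := inferInstance
  emb := coordPoint
  emb_injective := coordPoint_injective
  isLocallyClosed_range := isClosed_range_coordPoint.isLocallyClosed

/-- The Cartesian power, by `A⁰ = pt` and `Aⁿ⁺¹ = A × Aⁿ`. -/
noncomputable def pow (S : QProjStr A) : ∀ n : ℕ, QProjStr (Fin n → A)
  | 0 => discrete (Fin 0 → A)
  | n + 1 => (S.prod (S.pow n)).transport (Fin.consEquiv fun _ => A).symm

end QProjStr

/-! ### Regular maps: basic facts -/

section regular
variable {A B C D : Type} {S : QProjStr A} {T : QProjStr B} {R : QProjStr C} {Q : QProjStr D}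

lemma QProjStr.isOpen_univ (S : QProjStr A) : S.IsOpen Set.univ :=
  let _ := S.top
  _root_.isOpen_univ

lemma QProjStr.isOpen_inter {U V : Set A} (hU : S.IsOpen U) (hV : S.IsOpen V) :
    S.IsOpen (U ∩ V) :=
  let _ := S.top
  _root_.IsOpen.inter hU hV

lemma QProjStr.isOpen_basic (S : QProjStr A) {p : MvPolynomial S.σ ℂ} {d : ℕ}
    (hp : p.IsHomogeneous d) : S.IsOpen (S.emb ⁻¹' basicOpen p) :=
  ⟨_, isOpen_basicOpen hp, rfl⟩

/-- A map given in homogeneous coordinates by forms of the same degree is regular. -/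
lemma isRegular_of_forms {f : A → B} (d : ℕ) (F : T.σ → MvPolynomial S.σ ℂ)
    (hF : ∀ j, (F j).IsHomogeneous d) (h : ∀ b v, IsCoord (S.emb b) v →
      IsCoord (T.emb (f b)) (fun j => MvPolynomial.eval v (F j))) : IsRegular S T f :=
  fun _ => ⟨Set.univ, S.isOpen_univ, trivial, d, F, hF, fun b _ v hv => h b v hv⟩

lemma isRegular_of_linear {f : A → B} (k : T.σ → S.σ) (h : ∀ b v, IsCoord (S.emb b) v →
      IsCoord (T.emb (f b)) (fun j => v (k j))) : IsRegular S T f :=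
  isRegular_of_forms 1 (fun j => MvPolynomial.X (k j)) (fun _ => MvPolynomial.isHomogeneous_X _ _)
    fun b v hv => by simpa using h b v hv

lemma isRegular_id : IsRegular S S id := isRegular_of_linear id fun _ _ h => h

lemma IsRegular.continuous {f : A → B} (hf : IsRegular S T f) : @Continuous _ _ S.top T.top f := by
  let _ := S.top
  refine continuous_induced_rng.2 (continuous_generateFrom_iff.2 ?_)
  rintro _ ⟨p, e, hp, rfl⟩
  refine isOpen_iff_forall_mem_open.2 fun a ha => ?_
  obtain ⟨U, hU, haU, d, F, hF, h⟩ := hf a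
  have hq := hp.aeval F hF
  have key : ∀ b ∈ U, b ∈ S.emb ⁻¹' basicOpen (MvPolynomial.aeval F p) ↔
      b ∈ (T.emb ∘ f) ⁻¹' basicOpen p := by
    intro b hb
    rw [Set.mem_preimage, Set.mem_preimage, mem_basicOpen hq (isCoord_rep _), eval_aeval,
      Function.comp_apply, mem_basicOpen hp (h b hb _ (isCoord_rep _))]
  exact ⟨U ∩ S.emb ⁻¹' basicOpen (MvPolynomial.aeval F p),
    fun b hb => (key b hb.1).1 hb.2, QProjStr.isOpen_inter hU (S.isOpen_basic hq),
    haU, (key a haU).2 ha⟩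

lemma IsRegular.isOpen_preimage {f : A → B} (hf : IsRegular S T f) {U : Set B} (hU : T.IsOpen U) :
    S.IsOpen (f ⁻¹' U) :=
  let _ := S.top
  let _ := T.top
  hf.continuous.isOpen_preimage U hU

lemma IsRegular.isClosed_preimage {f : A → B} (hf : IsRegular S T f) {U : Set B}
    (hU : T.IsClosed U) : S.IsClosed (f ⁻¹' U) :=
  let _ := S.top
  let _ := T.top
  _root_.IsClosed.preimage hf.continuous hU

lemma IsRegular.isLocallyClosed_preimage {f : A → B} (hf : IsRegular S T f) {U : Set B}
    (hU : T.IsLocallyClosed U) : S.IsLocallyClosed (f ⁻¹' U) :=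
  let _ := S.top
  let _ := T.top
  _root_.IsLocallyClosed.preimage hU hf.continuous

lemma IsRegular.comp {f : A → B} {g : B → C} (hg : IsRegular T R g) (hf : IsRegular S T f) :
    IsRegular S R (g ∘ f) := by
  intro a
  obtain ⟨U, hU, haU, d, F, hF, h⟩ := hf a
  obtain ⟨V, hV, haV, e, G, hG, k⟩ := hg (f a)
  refine ⟨U ∩ f ⁻¹' V, QProjStr.isOpen_inter hU (hf.isOpen_preimage hV), ⟨haU, haV⟩, d * e,
    fun j => MvPolynomial.aeval F (G j), fun j => (hG j).aeval F hF, fun b hb v hv => ?_⟩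
  simp only [eval_aeval]
  exact k (f b) hb.2 _ (h b hb.1 v hv)

/-- Regularity is local. -/
lemma isRegular_of_local {f : A → B} (h : ∀ a, ∃ U, S.IsOpen U ∧ a ∈ U ∧
    ∃ g, IsRegular S T g ∧ ∀ b ∈ U, f b = g b) : IsRegular S T f := by
  intro a
  obtain ⟨U, hU, haU, g, hg, hfg⟩ := h a
  obtain ⟨V, hV, haV, d, F, hF, k⟩ := hg a
  refine ⟨U ∩ V, QProjStr.isOpen_inter hU hV, ⟨haU, haV⟩, d, F, hF, fun b hb v hv => ?_⟩
  rw [hfg b hb.1]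
  exact k b hb.2 v hv

lemma isRegular_of_eq {f g : A → B} (hg : IsRegular S T g) (h : ∀ a, f a = g a) :
    IsRegular S T f := (funext h : f = g) ▸ hg

lemma isRegular_const (b : B) : IsRegular S T (fun _ => b) := by
  intro a
  obtain ⟨s, hs⟩ := Function.ne_iff.1 (S.emb a).rep_nonzero
  have hX : (MvPolynomial.X s : MvPolynomial S.σ ℂ).IsHomogeneous 1 :=
    MvPolynomial.isHomogeneous_X _ _
  refine ⟨S.emb ⁻¹' basicOpen (MvPolynomial.X s), S.isOpen_basic hX, ?_, 1,
    fun j => MvPolynomial.C ((T.emb b).rep j) * MvPolynomial.X s,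
    fun j => hX.C_mul _, fun a' ha' v hv => ?_⟩
  · rw [Set.mem_preimage, mem_basicOpen hX (isCoord_rep _), MvPolynomial.eval_X]
    exact hs
  · rw [Set.mem_preimage, mem_basicOpen hX hv, MvPolynomial.eval_X] at ha'
    convert (isCoord_rep (T.emb b)).smul ha' using 1
    funext j
    simp [mul_comm]

lemma isRegular_transport (e : B ≃ A) : IsRegular (S.transport e) S e :=
  isRegular_of_linear id fun _ _ h => h

lemma isRegular_transport_symm (e : B ≃ A) : IsRegular S (S.transport e) e.symm :=
  isRegular_of_linear id fun b v h => by
    simpa [QProjStr.transport] using h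

lemma isRegular_val {s : Set A} (hs : S.IsLocallyClosed s) :
    IsRegular (S.restrict s hs) S Subtype.val :=
  isRegular_of_linear id fun _ _ h => h

lemma IsRegular.codRestrict {f : B → A} (hf : IsRegular T S f) {s : Set A}
    (hs : S.IsLocallyClosed s) (h : ∀ b, f b ∈ s) :
    IsRegular T (S.restrict s hs) (fun b => ⟨f b, h b⟩) := hf

lemma QProjStr.mem_basic_X (S : QProjStr A) {s : S.σ} {a : A} {v : S.σ → ℂ}
    (hv : IsCoord (S.emb a) v) : a ∈ S.emb ⁻¹' basicOpen (MvPolynomial.X s) ↔ v s ≠ 0 := by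
  rw [Set.mem_preimage, mem_basicOpen (MvPolynomial.isHomogeneous_X _ _) hv, MvPolynomial.eval_X]

lemma isRegular_of_linear_local {f : A → B} (h : ∀ a, ∃ (s : S.σ) (k : T.σ → S.σ),
    (S.emb a).rep s ≠ 0 ∧ ∀ b v, IsCoord (S.emb b) v → v s ≠ 0 →
      IsCoord (T.emb (f b)) (fun j => v (k j))) : IsRegular S T f := by
  intro a
  obtain ⟨s, k, hs, h⟩ := h a
  refine ⟨S.emb ⁻¹' basicOpen (MvPolynomial.X s),
    S.isOpen_basic (MvPolynomial.isHomogeneous_X _ _), (S.mem_basic_X (isCoord_rep _)).2 hs, 1,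
    fun j => MvPolynomial.X (k j), fun j => MvPolynomial.isHomogeneous_X _ _, fun b hb v hv => ?_⟩
  simpa using h b v hv ((S.mem_basic_X hv).1 hb)

lemma isRegular_fst : IsRegular (S.prod T) S Prod.fst := by
  refine isRegular_of_linear_local fun a => ?_
  obtain ⟨⟨s, t⟩, h⟩ := Function.ne_iff.1 ((S.prod T).emb a).rep_nonzero
  exact ⟨(s, t), fun j => (j, t), h, fun b v hv hb =>
    isCoord_fst (x := (S.emb b.1, T.emb b.2)) hv ⟨s, hb⟩⟩

lemma isRegular_snd : IsRegular (S.prod T) T Prod.snd := by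
  refine isRegular_of_linear_local fun a => ?_
  obtain ⟨⟨s, t⟩, h⟩ := Function.ne_iff.1 ((S.prod T).emb a).rep_nonzero
  exact ⟨(s, t), fun j => (s, j), h, fun b v hv hb =>
    isCoord_snd (x := (S.emb b.1, T.emb b.2)) hv ⟨t, hb⟩⟩

lemma IsRegular.prodMk {f : C → A} {g : C → B} (hf : IsRegular R S f) (hg : IsRegular R T g) :
    IsRegular R (S.prod T) (fun c => (f c, g c)) := by
  intro a
  obtain ⟨U, hU, haU, d, F, hF, h⟩ := hf a
  obtain ⟨V, hV, haV, e, G, hG, k⟩ := hg a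
  refine ⟨U ∩ V, QProjStr.isOpen_inter hU hV, ⟨haU, haV⟩, d + e, fun j => F j.1 * G j.2,
    fun j => (hF _).mul (hG _), fun b hb v hv => ?_⟩
  simp only [map_mul]
  exact (h b hb.1 v hv).segre (k b hb.2 v hv)

lemma IsRegular.prodMap {f : A → C} {g : B → D} (hf : IsRegular S R f) (hg : IsRegular T Q g) :
    IsRegular (S.prod T) (R.prod Q) (fun x => (f x.1, g x.2)) :=
  (hf.comp isRegular_fst).prodMk (hg.comp isRegular_snd)

lemma isRegular_inl : IsRegular S (S.sum T) Sum.inl :=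
  isRegular_of_forms 1 (fun j => (Sum.elim MvPolynomial.X (fun _ => 0) : S.σ ⊕ T.σ → _) j)
    (by
      rintro (s | t)
      · exact MvPolynomial.isHomogeneous_X _ _
      · exact MvPolynomial.isHomogeneous_zero _ _ _)
    (fun b v hv => by
      have : (fun j : S.σ ⊕ T.σ => MvPolynomial.eval v
          (Sum.elim MvPolynomial.X (fun _ => 0) j)) = Sum.elim v 0 := by
        funext j
        cases j <;> simp
      exact this ▸ hv.linl (τ := T.σ))

lemma isRegular_inr : IsRegular T (S.sum T) Sum.inr :=
  isRegular_of_forms 1 (fun j => (Sum.elim (fun _ => 0) MvPolynomial.X : S.σ ⊕ T.σ → _) j)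
    (by
      rintro (s | t)
      · exact MvPolynomial.isHomogeneous_zero _ _ _
      · exact MvPolynomial.isHomogeneous_X _ _)
    (fun b v hv => by
      have : (fun j : S.σ ⊕ T.σ => MvPolynomial.eval v
          (Sum.elim (fun _ => 0) MvPolynomial.X j)) = Sum.elim (0 : S.σ → ℂ) v := by
        funext j
        cases j <;> simp
      exact this ▸ hv.linr (σ := S.σ))

lemma isOpen_image_inl {U : Set A} (hU : S.IsOpen U) : (S.sum T).IsOpen (Sum.inl '' U) := by
  obtain ⟨U, hU, rfl⟩ := hU
  rw [isInducing_linl (τ := T.σ) |>.isOpen_iff] at hU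
  obtain ⟨W, hW, rfl⟩ := hU
  refine ⟨W ∩ (Set.range (linr S.σ))ᶜ, hW.inter isClosed_range_linr.isOpen_compl, ?_⟩
  ext (a | b)
  · refine ⟨fun h => ⟨a, h.1, rfl⟩, ?_⟩
    rintro ⟨a', h, h'⟩
    cases h'
    exact ⟨h, fun ⟨y, hy⟩ => linl_ne_linr _ _ hy.symm⟩
  · refine ⟨fun h => (h.2 ⟨_, rfl⟩).elim, ?_⟩
    rintro ⟨a', h, h'⟩
    cases h'

lemma isOpen_image_inr {U : Set B} (hU : T.IsOpen U) : (S.sum T).IsOpen (Sum.inr '' U) := by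
  obtain ⟨U, hU, rfl⟩ := hU
  rw [isInducing_linr (σ := S.σ) |>.isOpen_iff] at hU
  obtain ⟨W, hW, rfl⟩ := hU
  refine ⟨W ∩ (Set.range (linl T.σ))ᶜ, hW.inter isClosed_range_linl.isOpen_compl, ?_⟩
  ext (a | b)
  · refine ⟨fun h => (h.2 ⟨_, rfl⟩).elim, ?_⟩
    rintro ⟨a', h, h'⟩
    cases h'
  · refine ⟨fun h => ⟨b, h.1, rfl⟩, ?_⟩
    rintro ⟨a', h, h'⟩
    cases h'
    exact ⟨h, fun ⟨y, hy⟩ => linl_ne_linr _ _ hy⟩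

lemma IsRegular.sumElim {f : A → C} {g : B → C} (hf : IsRegular S R f) (hg : IsRegular T R g) :
    IsRegular (S.sum T) R (Sum.elim f g) := by
  rintro (a | a)
  · obtain ⟨U, hU, haU, d, F, hF, h⟩ := hf a
    refine ⟨Sum.inl '' U, isOpen_image_inl hU, ⟨a, haU, rfl⟩, d,
      fun j => MvPolynomial.rename Sum.inl (F j),
      fun j => MvPolynomial.IsHomogeneous.rename_isHomogeneous (hF j), ?_⟩
    rintro _ ⟨b, hb, rfl⟩ v hv
    have := h b hb _ (isCoord_of_linl hv).1
    refine (congrArg (IsCoord _) (funext fun j => ?_)).mp this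
    exact (MvPolynomial.eval_rename Sum.inl v (F j)).symm
  · obtain ⟨U, hU, haU, d, F, hF, h⟩ := hg a
    refine ⟨Sum.inr '' U, isOpen_image_inr hU, ⟨a, haU, rfl⟩, d,
      fun j => MvPolynomial.rename Sum.inr (F j),
      fun j => MvPolynomial.IsHomogeneous.rename_isHomogeneous (hF j), ?_⟩
    rintro _ ⟨b, hb, rfl⟩ v hv
    have := h b hb _ (isCoord_of_linr hv).1
    refine (congrArg (IsCoord _) (funext fun j => ?_)).mp this
    exact (MvPolynomial.eval_rename Sum.inr v (F j)).symm

lemma isOpen_discrete [Finite A] (s : Set A) : (QProjStr.discrete A).IsOpen s := by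
  have h : ∀ a : A, (QProjStr.discrete A).IsOpen {a} := by
    intro a
    convert (QProjStr.discrete A).isOpen_basic (MvPolynomial.isHomogeneous_X ℂ a) using 1
    ext b
    exact (Eq.comm.trans (coordPoint_mem a b).symm :)
  let _ := (QProjStr.discrete A).top
  have : s = ⋃ a ∈ s, {a} := by simp
  rw [this]
  exact isOpen_biUnion fun a _ => h a

/-- A map from the product of a finite set and a variety is regular if all its slices are. -/
lemma isRegular_discrete_prod [Finite A] {f : A × B → C}
    (h : ∀ a, IsRegular T R (fun b => f (a, b))) :
    IsRegular ((QProjStr.discrete A).prod T) R f := by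
  refine isRegular_of_local fun x => ⟨Prod.fst ⁻¹' {x.1},
    isRegular_fst.isOpen_preimage (isOpen_discrete _), rfl, _, (h x.1).comp isRegular_snd, ?_⟩
  rintro ⟨a, b⟩ rfl
  rfl

lemma isRegular_pow_apply : ∀ (n : ℕ) (i : Fin n), IsRegular (S.pow n) S (fun x => x i)
  | 0, i => i.elim0
  | n + 1, i => by
    have h1 : IsRegular (S.pow (n + 1)) (S.prod (S.pow n)) (Fin.consEquiv fun _ => A).symm :=
      isRegular_transport _
    refine Fin.cases ?_ (fun j => ?_) i
    · exact isRegular_fst.comp h1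
    · exact (isRegular_pow_apply n j).comp (isRegular_snd.comp h1)

lemma isRegular_pow : ∀ (n : ℕ) {f : B → Fin n → A}, (∀ i, IsRegular T S (fun b => f b i)) →
    IsRegular T (S.pow n) f
  | 0, f, _ => isRegular_of_eq (isRegular_const Fin.elim0) fun _ => Subsingleton.elim _ _
  | n + 1, f, h => by
    have h1 : IsRegular (S.prod (S.pow n)) (S.pow (n + 1)) (Fin.consEquiv fun _ => A) :=
      isRegular_transport_symm _
    have h2 : IsRegular T (S.pow n) (fun b i => f b i.succ) := isRegular_pow n fun i => h i.succ
    refine isRegular_of_eq (h1.comp ((h 0).prodMk h2)) fun b => ?_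
    exact (Fin.cons_self_tail (f b)).symm

end regular

/-! ### Varieties with actions of finite groups -/

/-- A quasi-projective `G`-variety: a quasi-projective variety with a left action of the group `G`
by regular maps. -/
structure GVar (G : Type) [Group G] where
  carrier : Type
  str : QProjStr carrier
  act : MulAction G carrier
  regular_smul : ∀ g : G, IsRegular str str (fun x => g • x)

attribute [instance] GVar.act

namespace GVar
variable {G H K : Type} [Group G] [Group H] [Group K]

/-- A set of points which is invariant under the group action. -/
def IsInvariant (Z : GVar G) (s : Set Z.carrier) : Prop := ∀ (g : G), ∀ x ∈ s, g • x ∈ s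

lemma IsInvariant.compl {Z : GVar G} {s : Set Z.carrier} (hs : Z.IsInvariant s) :
    Z.IsInvariant sᶜ := by
  intro g x hx h
  have := hs g⁻¹ _ h
  rw [inv_smul_smul] at this
  exact hx this

/-- A locally closed invariant subset as a `G`-variety. -/
def restrict (Z : GVar G) (s : Set Z.carrier) (hs : Z.str.IsLocallyClosed s)
    (hinv : Z.IsInvariant s) : GVar G where
  carrier := s
  str := Z.str.restrict s hs
  act :=
    { smul := fun g x => ⟨g • x.1, hinv g x.1 x.2⟩
      one_smul := fun x => Subtype.ext (one_smul G x.1)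
      mul_smul := fun g h x => Subtype.ext (mul_smul g h x.1) }
  regular_smul := fun g => ((Z.regular_smul g).comp (isRegular_val hs)).codRestrict hs _

/-- The product of a `G`-variety and a `K`-variety is a `G × K`-variety. -/
noncomputable def prod (Z : GVar G) (W : GVar K) : GVar (G × K) where
  carrier := Z.carrier × W.carrier
  str := Z.str.prod W.str
  act :=
    { smul := fun g x => (g.1 • x.1, g.2 • x.2)
      one_smul := fun x => Prod.ext (one_smul G x.1) (one_smul K x.2)
      mul_smul := fun g h x => Prod.ext (mul_smul g.1 h.1 x.1) (mul_smul g.2 h.2 x.2) }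
  regular_smul := fun g => (Z.regular_smul g.1).prodMap (W.regular_smul g.2)

/-- The disjoint union of two `G`-varieties. -/
noncomputable def sum (Z W : GVar G) : GVar G where
  carrier := Z.carrier ⊕ W.carrier
  str := Z.str.sum W.str
  act :=
    { smul := fun g => Sum.map (g • ·) (g • ·)
      one_smul := by
        rintro (x | x)
        · exact congrArg Sum.inl (one_smul G x)
        · exact congrArg Sum.inr (one_smul G x)
      mul_smul := by
        rintro g h (x | x)
        · exact congrArg Sum.inl (mul_smul g h x)
        · exact congrArg Sum.inr (mul_smul g h x) }
  regular_smul := fun g =>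
    (isRegular_inl.comp (Z.regular_smul g)).sumElim (isRegular_inr.comp (W.regular_smul g))

end GVar

/-- The wreath product `Gₙ = Gⁿ ⋊ Sₙ`, where `Sₙ` permutes the factors of `Gⁿ`. -/
abbrev Wreath (G : Type) [Group G] (n : ℕ) : Type := (Fin n → G) ⋊[mulAutArrow] Equiv.Perm (Fin n)

instance Wreath.finite (G : Type) [Group G] [Finite G] (n : ℕ) : Finite (Wreath G n) :=
  Finite.of_equiv _ SemidirectProduct.equivProd.symm

/-- The power `Zⁿ` of a `G`-variety, with the action of the wreath product in which `Gⁿ` acts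
componentwise and `Sₙ` permutes the components. -/
noncomputable def GVar.pow {G : Type} [Group G] (Z : GVar G) (n : ℕ) : GVar (Wreath G n) where
  carrier := Fin n → Z.carrier
  str := Z.str.pow n
  act :=
    { smul := fun g x i => g.left i • x (g.right⁻¹ i)
      one_smul := fun x => funext fun i => one_smul G (x i)
      mul_smul := fun g h x => funext fun i => by
        change (g.left i * h.left (g.right⁻¹ i)) • x ((g.right * h.right)⁻¹ i) =
          g.left i • h.left (g.right⁻¹ i) • x (h.right⁻¹ (g.right⁻¹ i))
        rw [mul_smul, mul_inv_rev, Equiv.Perm.mul_apply] }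
  regular_smul := fun g => isRegular_pow n fun i =>
    (Z.regular_smul (g.left i)).comp (isRegular_pow_apply n (g.right⁻¹ i))

/-! ### Induction -/

section ind
variable {G H : Type} [Group G] [Group H]

/-- The relation on `H × Z`, for an embedding `φ : G → H`:
`(h₁, x₁) ∼ (h₂, x₂)` if `h₂ = h₁ φ(g)⁻¹` and `x₂ = g x₁` for some `g ∈ G`. -/
def indSetoid (φ : G →* H) (Z : GVar G) : Setoid (H × Z.carrier) where
  r p q := ∃ g : G, q.1 = p.1 * (φ g)⁻¹ ∧ q.2 = g • p.2
  iseqv :=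
    { refl := fun p => ⟨1, by simp, by simp⟩
      symm := by
        rintro p q ⟨g, h1, h2⟩
        exact ⟨g⁻¹, by simp [h1], by simp [h2]⟩
      trans := by
        rintro p q r ⟨g, h1, h2⟩ ⟨k, h3, h4⟩
        exact ⟨k * g, by simp [h1, h3, mul_assoc], by simp [h2, h4, mul_smul]⟩ }

/-- The set `ind_G^H Z = (H × Z) / ∼`. -/
def IndSpace (φ : G →* H) (Z : GVar G) : Type := Quotient (indSetoid φ Z)

/-- The class of `(h, x)` in `ind_G^H Z`. -/
def IndSpace.mk (φ : G →* H) (Z : GVar G) (h : H) (x : Z.carrier) : IndSpace φ Z :=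
  Quotient.mk (indSetoid φ Z) (h, x)

lemma IndSpace.mk_eq_iff {φ : G →* H} {Z : GVar G} {h k : H} {x y : Z.carrier} :
    IndSpace.mk φ Z h x = IndSpace.mk φ Z k y ↔ ∃ g : G, k = h * (φ g)⁻¹ ∧ y = g • x :=
  Quotient.eq (r := indSetoid φ Z)

lemma IndSpace.mk_smul {φ : G →* H} {Z : GVar G} (h : H) (g : G) (x : Z.carrier) :
    IndSpace.mk φ Z h (g • x) = IndSpace.mk φ Z (h * φ g) x :=
  IndSpace.mk_eq_iff.2 ⟨g⁻¹, by simp, by simp⟩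

lemma IndSpace.ind {φ : G →* H} {Z : GVar G} {p : IndSpace φ Z → Prop}
    (h : ∀ k x, p (IndSpace.mk φ Z k x)) (a : IndSpace φ Z) : p a :=
  Quotient.ind (fun _ => h _ _) a

/-- The map `ind_G^H Z → T` induced by a map on `H × Z` compatible with the relation. -/
def IndSpace.lift {φ : G →* H} {Z : GVar G} {T : Type} (f : H → Z.carrier → T)
    (hf : ∀ h g x, f (h * (φ g)⁻¹) (g • x) = f h x) : IndSpace φ Z → T :=
  Quotient.lift (fun p => f p.1 p.2) (by
    rintro ⟨h, x⟩ ⟨k, y⟩ ⟨g, h1, h2⟩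
    change k = h * (φ g)⁻¹ at h1
    change y = g • x at h2
    subst h1 h2
    exact (hf h g x).symm)

/-- `H` acts on `ind_G^H Z` by left multiplication on the first component. -/
instance IndSpace.mulAction (φ : G →* H) (Z : GVar G) : MulAction H (IndSpace φ Z) where
  smul k := IndSpace.lift (fun h x => IndSpace.mk φ Z (k * h) x) (fun h g x => by
    rw [IndSpace.mk_smul]
    congr 1
    group)
  one_smul := IndSpace.ind fun h x => congrArg (IndSpace.mk φ Z · x) (one_mul h)
  mul_smul k l := IndSpace.ind fun h x => congrArg (IndSpace.mk φ Z · x) (mul_assoc k l h)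

lemma IndSpace.smul_mk {φ : G →* H} {Z : GVar G} (k h : H) (x : Z.carrier) :
    k • IndSpace.mk φ Z h x = IndSpace.mk φ Z (k * h) x := rfl

/-- The choice of representatives of the cosets of `φ(G)` identifies `ind_G^H Z` with
`(H / φ(G)) × Z`, i.e. with a disjoint union of copies of `Z`. -/
noncomputable def indEquiv (φ : G →* H) (hφ : Function.Injective φ) (Z : GVar G) :
    (H ⧸ φ.range) × Z.carrier ≃ IndSpace φ Z :=
  Equiv.ofBijective (fun p => IndSpace.mk φ Z p.1.out p.2) (by
    constructor
    · rintro ⟨c, x⟩ ⟨d, y⟩ h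
      obtain ⟨g, h1, h2⟩ := IndSpace.mk_eq_iff.1 h
      have hcd : c = d := by
        rw [← QuotientGroup.out_eq' c, ← QuotientGroup.out_eq' d, QuotientGroup.eq]
        exact ⟨g⁻¹, by simp only at h1; simp [h1]⟩
      subst hcd
      have hg : φ g = φ 1 := by
        rw [map_one]
        simpa using h1
      have := hφ hg
      subst this
      simp only [one_smul] at h2
      rw [h2]
    · refine IndSpace.ind fun h x => ?_
      have h1 : (QuotientGroup.mk ((h : H ⧸ φ.range).out) : H ⧸ φ.range) = h :=
        QuotientGroup.out_eq' _
      rw [QuotientGroup.eq] at h1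
      obtain ⟨g, hg⟩ := h1
      refine ⟨((h : H ⧸ φ.range), g • x), ?_⟩
      change IndSpace.mk φ Z _ (g • x) = _
      rw [IndSpace.mk_smul, hg, mul_inv_cancel_left])

variable [Finite H]

/-- The variety structure on `ind_G^H Z`: each coset of `φ(G)` in `H` contributes one copy of `Z`. -/
noncomputable def indStr (φ : G →* H) (hφ : Function.Injective φ) (Z : GVar G) :
    QProjStr (IndSpace φ Z) :=
  ((QProjStr.discrete (H ⧸ φ.range)).prod Z.str).transport (indEquiv φ hφ Z).symm

lemma isRegular_ind_mk (φ : G →* H) (hφ : Function.Injective φ) (Z : GVar G) (h : H) :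
    IsRegular Z.str (indStr φ hφ Z) (IndSpace.mk φ Z h) := by
  have h1 : (QuotientGroup.mk ((h : H ⧸ φ.range).out) : H ⧸ φ.range) = h :=
    QuotientGroup.out_eq' _
  rw [QuotientGroup.eq] at h1
  obtain ⟨g, hg⟩ := h1
  have h2 : IsRegular ((QProjStr.discrete (H ⧸ φ.range)).prod Z.str) (indStr φ hφ Z)
      (indEquiv φ hφ Z) := isRegular_transport_symm _
  refine isRegular_of_eq (h2.comp ((isRegular_const (h : H ⧸ φ.range)).prodMk
    (Z.regular_smul g))) fun x => ?_
  change _ = IndSpace.mk φ Z _ (g • x)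
  rw [IndSpace.mk_smul, hg, mul_inv_cancel_left]

/-- A map from `ind_G^H Z × B` is regular if it is so on each copy of `Z × B`. -/
lemma isRegular_of_ind_prod {φ : G →* H} {hφ : Function.Injective φ} {Z : GVar G} {B C : Type}
    {T : QProjStr B} {R : QProjStr C} {f : IndSpace φ Z × B → C}
    (hf : ∀ h, IsRegular (Z.str.prod T) R (fun p => f (IndSpace.mk φ Z h p.1, p.2))) :
    IsRegular ((indStr φ hφ Z).prod T) R f := by
  have h1 : IsRegular (indStr φ hφ Z) ((QProjStr.discrete (H ⧸ φ.range)).prod Z.str)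
      (indEquiv φ hφ Z).symm := isRegular_transport _
  have h2 := (h1.comp isRegular_fst).prodMk (isRegular_snd (S := indStr φ hφ Z) (T := T))
  refine isRegular_of_local fun a => ?_
  set c := ((indEquiv φ hφ Z).symm a.1).1 with hc
  refine ⟨{b | ((indEquiv φ hφ Z).symm b.1).1 = c},
    ((isRegular_fst.comp h1).comp isRegular_fst).isOpen_preimage (isOpen_discrete {c}), rfl, _,
    (hf c.out).comp (((isRegular_snd.comp h1).comp isRegular_fst).prodMk isRegular_snd), ?_⟩
  intro b hb
  simp only [Function.comp_apply]
  congr 1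
  refine Prod.ext ?_ rfl
  obtain ⟨⟨d, z⟩, hz⟩ := (indEquiv φ hφ Z).surjective b.1
  simp only [Set.mem_ofPred_eq, ← hz, Equiv.symm_apply_apply] at hb ⊢
  rw [← hb]
  rfl

lemma isRegular_of_ind {φ : G →* H} {hφ : Function.Injective φ} {Z : GVar G} {C : Type}
    {R : QProjStr C} {f : IndSpace φ Z → C}
    (hf : ∀ h, IsRegular Z.str R (fun x => f (IndSpace.mk φ Z h x))) :
    IsRegular (indStr φ hφ Z) R f := by
  have : IsRegular ((indStr φ hφ Z).prod (QProjStr.discrete Unit)) R (fun p => f p.1) :=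
    isRegular_of_ind_prod fun h => (hf h).comp isRegular_fst
  exact this.comp (isRegular_id.prodMk (isRegular_const ()))

/-- The induced `H`-variety `ind_G^H Z`, for an embedding `φ : G → H`. -/
noncomputable def GVar.ind (φ : G →* H) (hφ : Function.Injective φ) (Z : GVar G) : GVar H where
  carrier := IndSpace φ Z
  str := indStr φ hφ Z
  act := IndSpace.mulAction φ Z
  regular_smul := fun k => isRegular_of_ind fun h => isRegular_ind_mk φ hφ Z (k * h)

end ind

/-- A variety with a pure action `(Z, G)`: a finite group `G` and a quasi-projective
`G`-variety `Z`. -/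
structure PureVar where
  grp : Type
  [group : Group grp]
  [finite : Finite grp]
  var : GVar grp

attribute [instance] PureVar.group PureVar.finite

/-- An isomorphism of varieties with pure actions: an isomorphism `φ` of groups and an isomorphism
`ψ` of varieties with `ψ (g x) = φ(g) ψ(x)`. -/
structure PureIso (P Q : PureVar) where
  φ : P.grp ≃* Q.grp
  ψ : P.var.carrier ≃ Q.var.carrier
  regular : IsRegular P.var.str Q.var.str ψ
  regular_symm : IsRegular Q.var.str P.var.str ψ.symm
  equivariant : ∀ (g : P.grp) (x : P.var.carrier), ψ (g • x) = φ g • ψ x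

namespace PureVar

/-- The restriction of a pure action to a locally closed invariant subset. -/
def restrict (P : PureVar) (s : Set P.var.carrier) (hs : P.var.str.IsLocallyClosed s)
    (hinv : P.var.IsInvariant s) : PureVar :=
  ⟨P.grp, P.var.restrict s hs hinv⟩

/-- `(Z₁, G₁) × (Z₂, G₂) = (Z₁ × Z₂, G₁ × G₂)`. -/
noncomputable def prod (P Q : PureVar) : PureVar := ⟨P.grp × Q.grp, P.var.prod Q.var⟩

end PureVar

/-- A variety with a finite groups action: a finite disjoint union of varieties `Xᵢ` with actions
of finite groups `Gᵢ`. -/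
structure FGrVar where
  ι : Type
  [fintype : Fintype ι]
  comp : ι → PureVar

attribute [instance] FGrVar.fintype

namespace FGrVar

/-- A variety with a pure action, as a variety with a finite groups action. -/
def ofPure (P : PureVar) : FGrVar := ⟨Unit, fun _ => P⟩

/-- The subvariety consisting of invariant locally closed subsets of the components. -/
def restrict (X : FGrVar) (s : ∀ i, Set (X.comp i).var.carrier)
    (hs : ∀ i, (X.comp i).var.str.IsLocallyClosed (s i))
    (hinv : ∀ i, (X.comp i).var.IsInvariant (s i)) : FGrVar :=
  ⟨X.ι, fun i => (X.comp i).restrict (s i) (hs i) (hinv i)⟩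

/-- The Cartesian product. -/
noncomputable def prod (X Y : FGrVar) : FGrVar :=
  ⟨X.ι × Y.ι, fun k => (X.comp k.1).prod (Y.comp k.2)⟩

/-- A partition, with pieces indexed by `ν`: every piece is a locally closed invariant subset of
one of the components, and every point of every component lies in exactly one piece. -/
structure Partition (X : FGrVar) (ν : Type) where
  idx : ν → X.ι
  set : ∀ k, Set (X.comp (idx k)).var.carrier
  isLocallyClosed : ∀ k, (X.comp (idx k)).var.str.IsLocallyClosed (set k)
  isInvariant : ∀ k, (X.comp (idx k)).var.IsInvariant (set k)
  bijective : Function.Bijective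
    (fun p : (Σ k, set k) => (⟨idx p.1, p.2.1⟩ : Σ i, (X.comp i).var.carrier))

/-- A piece of a partition, with the action of the group of the component that contains it. -/
def Partition.piece {X : FGrVar} {ν : Type} (P : X.Partition ν) (k : ν) : PureVar :=
  (X.comp (P.idx k)).restrict (P.set k) (P.isLocallyClosed k) (P.isInvariant k)

/-- Equivalence: the existence of finite partitions with pairwise isomorphic pieces. -/
def Equivalent (X Y : FGrVar) : Prop :=
  ∃ (ν : Type) (_ : Finite ν) (P : X.Partition ν) (Q : Y.Partition ν),
    ∀ k, Nonempty (PureIso (P.piece k) (Q.piece k))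

end FGrVar

lemma QProjStr.IsClosed.isLocallyClosed {A : Type} {S : QProjStr A} {s : Set A}
    (h : S.IsClosed s) : S.IsLocallyClosed s :=
  let _ := S.top
  _root_.IsClosed.isLocallyClosed h

lemma QProjStr.IsClosed.isLocallyClosed_compl {A : Type} {S : QProjStr A} {s : Set A}
    (h : S.IsClosed s) : S.IsLocallyClosed sᶜ :=
  let _ := S.top
  _root_.IsOpen.isLocallyClosed (_root_.IsClosed.isOpen_compl (self := h))

/-! ### The Grothendieck ring of varieties with finite groups actions -/

/-- The defining relations of the Grothendieck group `K₀^{fGr}(Var_ℂ)`. -/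
inductive Rel : FreeAbelianGroup FGrVar → Prop
  /-- `[X] = [Y]` if `X` and `Y` are equivalent. -/
  | equivalent (X Y : FGrVar) (h : X.Equivalent Y) :
      Rel (FreeAbelianGroup.of X - FreeAbelianGroup.of Y)
  /-- `[X] = [Y] + [X \ Y]` for a Zariski closed invariant subvariety `Y` of `X`. -/
  | closed (X : FGrVar) (s : ∀ i, Set (X.comp i).var.carrier)
      (hs : ∀ i, (X.comp i).var.str.IsClosed (s i))
      (hinv : ∀ i, (X.comp i).var.IsInvariant (s i)) :
      Rel (FreeAbelianGroup.of X -
        (FreeAbelianGroup.of (X.restrict s (fun i => (hs i).isLocallyClosed) hinv) +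
          FreeAbelianGroup.of (X.restrict (fun i => (s i)ᶜ)
            (fun i => (hs i).isLocallyClosed_compl) (fun i => (hinv i).compl))))
  /-- `[(ind_G^H Z, H)] = [(Z, G)]` for a `G`-variety `Z` and an embedding `G → H`. -/
  | ind (G H : Type) [Group G] [Finite G] [Group H] [Finite H] (φ : G →* H)
      (hφ : Function.Injective φ) (Z : GVar G) :
      Rel (FreeAbelianGroup.of (FGrVar.ofPure ⟨H, Z.ind φ hφ⟩) -
        FreeAbelianGroup.of (FGrVar.ofPure ⟨G, Z⟩))

/-- The subgroup generated by the relations. -/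
def relSubgroup : AddSubgroup (FreeAbelianGroup FGrVar) := AddSubgroup.closure {a | Rel a}

/-- The Grothendieck ring `K₀^{fGr}(Var_ℂ)` of quasi-projective varieties with finite groups
actions: the abelian group generated by the classes of such varieties modulo the relations. -/
def K0fGr : Type 1 := FreeAbelianGroup FGrVar ⧸ relSubgroup

namespace K0fGr

noncomputable instance : AddCommGroup K0fGr :=
  inferInstanceAs (AddCommGroup (FreeAbelianGroup FGrVar ⧸ relSubgroup))

/-- The class of a variety with a finite groups action. -/
noncomputable def cls (X : FGrVar) : K0fGr :=
  QuotientAddGroup.mk' relSubgroup (FreeAbelianGroup.of X)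

/-- The class `[(Z, G)]` of a variety with a pure action. -/
noncomputable def pureCls {G : Type} [Group G] [Finite G] (Z : GVar G) : K0fGr :=
  cls (FGrVar.ofPure ⟨G, Z⟩)

end K0fGr

/-! Well-definedness of the multiplication. -/

namespace PureIso

/-- The identity. -/
def refl (P : PureVar) : PureIso P P :=
  ⟨MulEquiv.refl _, Equiv.refl _, isRegular_id, isRegular_id, fun _ _ => rfl⟩

/-- The inverse isomorphism. -/
def symm {P Q : PureVar} (e : PureIso P Q) : PureIso Q P :=
  ⟨e.φ.symm, e.ψ.symm, e.regular_symm, e.regular, fun g x => by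
    rw [Equiv.symm_apply_eq, e.equivariant, MulEquiv.apply_symm_apply, Equiv.apply_symm_apply]⟩

/-- The composition of isomorphisms. -/
def trans {P Q R : PureVar} (e : PureIso P Q) (f : PureIso Q R) : PureIso P R :=
  ⟨e.φ.trans f.φ, e.ψ.trans f.ψ, f.regular.comp e.regular, e.regular_symm.comp f.regular_symm,
    fun g x => by simp [e.equivariant, f.equivariant]⟩

/-- The product of isomorphisms. -/
noncomputable def prodCongr {P Q P' Q' : PureVar} (e : PureIso P Q) (f : PureIso P' Q') :
    PureIso (P.prod P') (Q.prod Q') :=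
  ⟨e.φ.prodCongr f.φ, e.ψ.prodCongr f.ψ, e.regular.prodMap f.regular,
    e.regular_symm.prodMap f.regular_symm, fun g x =>
      Prod.ext (e.equivariant g.1 x.1) (f.equivariant g.2 x.2)⟩

/-- The commutativity of the product. -/
noncomputable def prodComm (P Q : PureVar) : PureIso (P.prod Q) (Q.prod P) :=
  ⟨MulEquiv.prodComm, Equiv.prodComm _ _, isRegular_snd.prodMk isRegular_fst,
    isRegular_snd.prodMk isRegular_fst, fun _ _ => rfl⟩

/-- The associativity of the product. -/
noncomputable def prodAssoc (P Q R : PureVar) : PureIso ((P.prod Q).prod R) (P.prod (Q.prod R)) :=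
  ⟨MulEquiv.prodAssoc, Equiv.prodAssoc _ _ _,
    (isRegular_fst.comp isRegular_fst).prodMk
      ((isRegular_snd.comp isRegular_fst).prodMk isRegular_snd),
    (isRegular_fst.prodMk (isRegular_fst.comp isRegular_snd)).prodMk
      (isRegular_snd.comp isRegular_snd), fun _ _ => rfl⟩

/-- An isomorphism restricts to corresponding invariant subsets. -/
def restrict {P Q : PureVar} (e : PureIso P Q) {s : Set P.var.carrier} {t : Set Q.var.carrier}
    (h : ∀ x, x ∈ s ↔ e.ψ x ∈ t) (hs : P.var.str.IsLocallyClosed s) (hs' : P.var.IsInvariant s)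
    (ht : Q.var.str.IsLocallyClosed t) (ht' : Q.var.IsInvariant t) :
    PureIso (P.restrict s hs hs') (Q.restrict t ht ht') :=
  ⟨e.φ, e.ψ.subtypeEquiv h, (e.regular.comp (isRegular_val hs)).codRestrict ht _,
    (e.regular_symm.comp (isRegular_val ht)).codRestrict hs _,
    fun g x => Subtype.ext (e.equivariant g x.1)⟩

/-- The restriction to the whole variety. -/
def restrictUniv {P : PureVar} {s : Set P.var.carrier} (h : ∀ x, x ∈ s)
    (hs : P.var.str.IsLocallyClosed s) (hs' : P.var.IsInvariant s) :
    PureIso (P.restrict s hs hs') P :=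
  ⟨MulEquiv.refl _, Equiv.subtypeUnivEquiv h, isRegular_val hs,
    isRegular_id.codRestrict hs h, fun _ _ => rfl⟩

/-- `(S × W) ≅ S × W` for an invariant subset `S` of the first factor. -/
noncomputable def restrictFst {P Q : PureVar} {s : Set P.var.carrier} (hs : P.var.str.IsLocallyClosed s)
    (hs' : P.var.IsInvariant s)
    (ht : (P.prod Q).var.str.IsLocallyClosed (Prod.fst ⁻¹' s))
    (ht' : (P.prod Q).var.IsInvariant (Prod.fst ⁻¹' s)) :
    PureIso ((P.prod Q).restrict (Prod.fst ⁻¹' s) ht ht') ((P.restrict s hs hs').prod Q) where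
  φ := MulEquiv.refl _
  ψ :=
    { toFun := fun x => (⟨x.1.1, x.2⟩, x.1.2)
      invFun := fun x => ⟨(x.1.1, x.2), x.1.2⟩
      left_inv := fun _ => rfl
      right_inv := fun _ => rfl }
  regular := ((isRegular_fst.comp (isRegular_val ht)).codRestrict hs _).prodMk
    (isRegular_snd.comp (isRegular_val ht))
  regular_symm := (((isRegular_val hs).comp isRegular_fst).prodMk isRegular_snd).codRestrict ht _
  equivariant := fun _ _ => rfl

/-- `(ind_G^H Z) × W ≅ ind_{G × K}^{H × K} (Z × W)`. -/
noncomputable def indProd {G H : Type} [Group G] [Finite G] [Group H] [Finite H] (φ : G →* H)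
    (hφ : Function.Injective φ) (Z : GVar G) (Q : PureVar)
    (hφ' : Function.Injective (φ.prodMap (MonoidHom.id Q.grp))) :
    PureIso (PureVar.prod ⟨H, Z.ind φ hφ⟩ Q)
      ⟨H × Q.grp, (Z.prod Q.var).ind (φ.prodMap (MonoidHom.id Q.grp)) hφ'⟩ where
  φ := MulEquiv.refl _
  ψ :=
    { toFun := fun p => IndSpace.lift (fun h x =>
          IndSpace.mk (φ.prodMap (MonoidHom.id Q.grp)) (Z.prod Q.var) (h, 1) (x, p.2))
        (fun h g x => IndSpace.mk_eq_iff.2 ⟨(g⁻¹, 1), by simp,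
          Prod.ext (inv_smul_smul g x).symm (one_smul _ p.2).symm⟩) p.1
      invFun := IndSpace.lift (fun h x => (IndSpace.mk φ Z h.1 x.1, h.2 • x.2)) (by
        rintro ⟨h, k⟩ ⟨g, l⟩ ⟨x, w⟩
        refine Prod.ext (IndSpace.mk_eq_iff.2 ⟨g⁻¹, by simp, (inv_smul_smul g x).symm⟩) ?_
        change (k * l⁻¹) • l • w = k • w
        rw [smul_smul, inv_mul_cancel_right])
      left_inv := by
        rintro ⟨a, w⟩
        revert a
        exact IndSpace.ind fun h x => Prod.ext rfl (one_smul _ w)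
      right_inv := IndSpace.ind (by
        rintro ⟨h, k⟩ ⟨x, w⟩
        exact IndSpace.mk_eq_iff.2 ⟨(1, k⁻¹), by simp,
          Prod.ext (one_smul _ x).symm (inv_smul_smul k w).symm⟩) }
  regular := isRegular_of_ind_prod fun h => isRegular_ind_mk _ hφ' (Z.prod Q.var) (h, 1)
  regular_symm := isRegular_of_ind fun h => ((isRegular_ind_mk φ hφ Z h.1).comp
    isRegular_fst).prodMk ((Q.var.regular_smul h.2).comp isRegular_snd)
  equivariant := by
    rintro ⟨h, k⟩ ⟨a, w⟩
    revert a
    refine IndSpace.ind fun h' x => IndSpace.mk_eq_iff.2 ⟨(1, k⁻¹), Prod.ext ?_ ?_,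
      Prod.ext (one_smul _ x).symm (inv_smul_smul k w).symm⟩
    · change h * h' = h * h' * (φ 1)⁻¹
      simp
    · change k * 1 = 1 * k⁻¹⁻¹
      simp

end PureIso

lemma QProjStr.isClosed_univ {A : Type} (S : QProjStr A) : S.IsClosed Set.univ :=
  let _ := S.top
  _root_.isClosed_univ

lemma QProjStr.isClosed_empty {A : Type} (S : QProjStr A) : S.IsClosed ∅ :=
  let _ := S.top
  _root_.isClosed_empty

namespace FGrVar

/-- Families with isomorphic components, up to empty components, are equivalent. -/
lemma equivalent_of_iso {X Y : FGrVar} (j : Y.ι → X.ι) (hj : Function.Injective j)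
    (h : ∀ k, Nonempty (PureIso (X.comp (j k)) (Y.comp k)))
    (hempty : ∀ i, i ∉ Set.range j → IsEmpty (X.comp i).var.carrier) : X.Equivalent Y := by
  refine ⟨Y.ι, inferInstance,
    ⟨j, fun _ => Set.univ, fun _ => (QProjStr.isClosed_univ _).isLocallyClosed,
      fun _ _ _ _ => trivial, ?_, ?_⟩,
    ⟨id, fun _ => Set.univ, fun _ => (QProjStr.isClosed_univ _).isLocallyClosed,
      fun _ _ _ _ => trivial, ?_, ?_⟩, fun k => ?_⟩
  · rintro ⟨k, x, hx⟩ ⟨l, y, hy⟩ h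
    have hkl : k = l := hj (congrArg Sigma.fst h)
    subst hkl
    simp only [Sigma.mk.injEq, heq_eq_eq, true_and] at h
    subst h
    rfl
  · rintro ⟨i, x⟩
    by_cases hi : i ∈ Set.range j
    · obtain ⟨k, rfl⟩ := hi
      exact ⟨⟨k, x, trivial⟩, rfl⟩
    · exact ((hempty i hi).false x).elim
  · rintro ⟨k, x, hx⟩ ⟨l, y, hy⟩ h
    cases h
    rfl
  · rintro ⟨i, x⟩
    exact ⟨⟨i, x, trivial⟩, rfl⟩
  · obtain ⟨e⟩ := h k
    exact ⟨e.restrict (s := Set.univ) (t := Set.univ) (fun _ => by simp) _ _ _ _⟩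

/-- The partition of `X × Y` induced by a partition of `X`. -/
noncomputable def Partition.prod {X : FGrVar} {ν : Type} (P : X.Partition ν) (Y : FGrVar) :
    (X.prod Y).Partition (ν × Y.ι) where
  idx := fun k => (P.idx k.1, k.2)
  set := fun k => Prod.fst ⁻¹' P.set k.1
  isLocallyClosed := fun k => isRegular_fst.isLocallyClosed_preimage (P.isLocallyClosed k.1)
  isInvariant := fun k g x hx => P.isInvariant k.1 g.1 x.1 hx
  bijective := by
    constructor
    · rintro ⟨⟨k, j⟩, ⟨x, w⟩, hx⟩ ⟨⟨k', j'⟩, ⟨x', w'⟩, hx'⟩ h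
      have h1 := congrArg (fun p : (Σ i : X.ι × Y.ι, (X.comp i.1).var.carrier ×
        (Y.comp i.2).var.carrier) => (⟨p.1.1, p.2.1⟩ : Σ i, (X.comp i).var.carrier)) h
      have h2 := congrArg (fun p : (Σ i : X.ι × Y.ι, (X.comp i.1).var.carrier ×
        (Y.comp i.2).var.carrier) => (⟨p.1.2, p.2.2⟩ : Σ i, (Y.comp i).var.carrier)) h
      have h3 := P.bijective.1 (a₁ := ⟨k, x, hx⟩) (a₂ := ⟨k', x', hx'⟩) h1
      cases h3
      cases h2
      rfl
    · rintro ⟨⟨i, j⟩, ⟨x, w⟩⟩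
      obtain ⟨⟨k, y, hy⟩, h⟩ := P.bijective.2 ⟨i, x⟩
      cases h
      exact ⟨⟨(k, j), (y, w), hy⟩, rfl⟩

lemma Equivalent.prod {X Y : FGrVar} (h : X.Equivalent Y) (Z : FGrVar) :
    (X.prod Z).Equivalent (Y.prod Z) := by
  obtain ⟨ν, hν, P, Q, h⟩ := h
  refine ⟨ν × Z.ι, inferInstance, P.prod Z, Q.prod Z, fun k => ?_⟩
  obtain ⟨e⟩ := h k.1
  exact ⟨((PureIso.restrictFst (P.isLocallyClosed k.1) (P.isInvariant k.1) _ _).trans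
    (e.prodCongr (PureIso.refl _))).trans
    (PureIso.restrictFst (Q.isLocallyClosed k.1) (Q.isInvariant k.1) _ _).symm⟩

end FGrVar

namespace K0fGr

lemma mk_eq_of_rel {a b : FreeAbelianGroup FGrVar} (h : Rel (a - b)) :
    QuotientAddGroup.mk' relSubgroup a = QuotientAddGroup.mk' relSubgroup b := by
  rw [← sub_eq_zero, ← map_sub]
  exact (QuotientAddGroup.eq_zero_iff _).2 (AddSubgroup.subset_closure h)

lemma cls_eq_of_equivalent {X Y : FGrVar} (h : X.Equivalent Y) : cls X = cls Y :=
  mk_eq_of_rel (Rel.equivalent X Y h)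

lemma cls_eq_of_iso {X Y : FGrVar} (j : Y.ι ≃ X.ι)
    (h : ∀ k, Nonempty (PureIso (X.comp (j k)) (Y.comp k))) : cls X = cls Y :=
  cls_eq_of_equivalent (FGrVar.equivalent_of_iso j j.injective h
    fun i hi => (hi (j.surjective i)).elim)

lemma cls_closed (X : FGrVar) (s : ∀ i, Set (X.comp i).var.carrier)
    (hs : ∀ i, (X.comp i).var.str.IsClosed (s i))
    (hinv : ∀ i, (X.comp i).var.IsInvariant (s i)) :
    cls X = cls (X.restrict s (fun i => (hs i).isLocallyClosed) hinv) +
      cls (X.restrict (fun i => (s i)ᶜ) (fun i => (hs i).isLocallyClosed_compl)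
        (fun i => (hinv i).compl)) := by
  have := mk_eq_of_rel (Rel.closed X s hs hinv)
  rwa [map_add] at this

lemma pureCls_ind {G H : Type} [Group G] [Finite G] [Group H] [Finite H] (φ : G →* H)
    (hφ : Function.Injective φ) (Z : GVar G) : pureCls (Z.ind φ hφ) = pureCls Z :=
  mk_eq_of_rel (Rel.ind G H φ hφ Z)

lemma cls_of_isEmpty (X : FGrVar) [IsEmpty X.ι] : cls X = 0 := by
  have h := cls_closed X (fun _ => Set.univ) (fun _ => QProjStr.isClosed_univ _)
    (fun _ _ _ _ => trivial)
  have h1 : ∀ Y : FGrVar, IsEmpty Y.ι → cls X = cls Y := fun Y _ =>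
    cls_eq_of_iso (Equiv.equivOfIsEmpty _ _) fun k => isEmptyElim k
  have h2 := h1 (X.restrict (fun _ => Set.univ)
    (fun i => (QProjStr.isClosed_univ _).isLocallyClosed) (fun _ _ _ _ => trivial)) ‹_›
  have h3 := h1 (X.restrict (fun _ => Set.univᶜ)
    (fun i => (QProjStr.isClosed_univ _).isLocallyClosed_compl)
    (fun _ => GVar.IsInvariant.compl fun _ _ _ => trivial)) ‹_›
  exact left_eq_add.1 (h.trans (congrArg₂ (· + ·) h2.symm h3.symm))

lemma cls_option {α : Type} [Fintype α] (c : Option α → PureVar) :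
    cls ⟨Option α, c⟩ = cls (FGrVar.ofPure (c none)) + cls ⟨α, fun a => c (some a)⟩ := by
  rw [cls_closed ⟨Option α, c⟩ (fun i => {_x | i = none})
    (fun i => by
      cases i
      · simpa using QProjStr.isClosed_univ _
      · simpa using QProjStr.isClosed_empty _)
    (fun _ _ _ h => h)]
  congr 1
  · refine cls_eq_of_equivalent (FGrVar.equivalent_of_iso (fun _ => none)
      (fun _ _ _ => rfl) (fun k => ⟨PureIso.restrictUniv (fun _ => rfl) _ _⟩) ?_)
    · intro i hi
      refine ⟨fun x => hi ⟨(), x.2.symm⟩⟩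
  · refine cls_eq_of_equivalent (FGrVar.equivalent_of_iso some
      (Option.some_injective _) (fun k => ⟨PureIso.restrictUniv
        (s := {_x | some k = none}ᶜ) (fun _ (h : some k = none) => nomatch h) _ _⟩) ?_)
    · intro i hi
      refine ⟨fun x => ?_⟩
      cases i with
      | none => exact x.2 rfl
      | some a => exact hi ⟨a, rfl⟩

/-- `[⊔ (Xᵢ, Gᵢ)] = ∑ [(Xᵢ, Gᵢ)]`. -/
lemma cls_eq_sum (X : FGrVar) : cls X = ∑ i, cls (FGrVar.ofPure (X.comp i)) := by
  obtain ⟨ι, c⟩ := X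
  refine Fintype.induction_empty_option (P := fun α _ => ∀ c : α → PureVar,
    cls ⟨α, c⟩ = ∑ i, cls (FGrVar.ofPure (c i))) ?_ ?_ ?_ ι c
  · intro α β _ e ih c
    let _ := Fintype.ofEquiv β e.symm
    rw [← Equiv.sum_comp e, ← ih fun i => c (e i)]
    exact cls_eq_of_iso (X := ⟨β, c⟩) (Y := ⟨α, fun i => c (e i)⟩) e fun k => ⟨PureIso.refl _⟩
  · intro c
    have : IsEmpty (FGrVar.mk PEmpty c).ι := inferInstanceAs (IsEmpty PEmpty)
    rw [cls_of_isEmpty, Finset.univ_eq_empty, Finset.sum_empty]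
  · intro α _ ih c
    rw [cls_option, ih, Fintype.sum_option]

/-- The multiplication on the free abelian group. -/
noncomputable def preMul :
    FreeAbelianGroup FGrVar →+ FreeAbelianGroup FGrVar →+ K0fGr :=
  FreeAbelianGroup.lift fun X => FreeAbelianGroup.lift fun Y => cls (X.prod Y)

lemma preMul_of (X Y : FGrVar) :
    preMul (FreeAbelianGroup.of X) (FreeAbelianGroup.of Y) = cls (X.prod Y) := by
  simp [preMul]

lemma cls_prod_comm (X Y : FGrVar) : cls (X.prod Y) = cls (Y.prod X) :=
  cls_eq_of_iso (Equiv.prodComm _ _) fun _ => ⟨PureIso.prodComm _ _⟩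

lemma cls_prod_assoc (X Y Z : FGrVar) : cls ((X.prod Y).prod Z) = cls (X.prod (Y.prod Z)) :=
  cls_eq_of_iso (Equiv.prodAssoc _ _ _).symm fun _ => ⟨PureIso.prodAssoc _ _ _⟩

lemma cls_ofPure_prod (P : PureVar) (Y : FGrVar) :
    cls ((FGrVar.ofPure P).prod Y) = ∑ j, cls (FGrVar.ofPure (P.prod (Y.comp j))) := by
  have := cls_eq_of_iso (X := (FGrVar.ofPure P).prod Y) (Y := ⟨Y.ι, fun j => P.prod (Y.comp j)⟩)
    (Equiv.punitProd _).symm fun k => ⟨PureIso.refl _⟩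
  rw [this, cls_eq_sum]

lemma cls_eq_of_pureIso {P Q : PureVar} (e : PureIso P Q) :
    cls (FGrVar.ofPure P) = cls (FGrVar.ofPure Q) :=
  cls_eq_of_iso (X := FGrVar.ofPure P) (Y := FGrVar.ofPure Q) (Equiv.refl _) fun _ => ⟨e⟩

lemma preMul_flip : preMul.flip = preMul := by
  refine FreeAbelianGroup.lift_ext _ _ fun X => FreeAbelianGroup.lift_ext _ _ fun Y => ?_
  rw [AddMonoidHom.flip_apply, preMul_of, preMul_of, cls_prod_comm]

/-- The multiplication is compatible with the relations. -/
lemma preMul_rel {a : FreeAbelianGroup FGrVar} (ha : Rel a) : preMul a = 0 := by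
  refine FreeAbelianGroup.lift_ext _ _ fun W => ?_
  rw [AddMonoidHom.zero_apply]
  cases ha with
  | equivalent X Y h =>
    rw [map_sub, AddMonoidHom.sub_apply, preMul_of, preMul_of, sub_eq_zero]
    exact cls_eq_of_equivalent (h.prod W)
  | closed X s hs hinv =>
    rw [map_sub, map_add, AddMonoidHom.sub_apply, AddMonoidHom.add_apply, preMul_of, preMul_of,
      preMul_of, sub_eq_zero, cls_closed (X.prod W) (fun k => Prod.fst ⁻¹' s k.1)
        (fun k => isRegular_fst.isClosed_preimage (hs k.1))
        (fun k g x hx => hinv k.1 g.1 x.1 hx)]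
    congr 1
    · exact cls_eq_of_iso (Equiv.refl _) fun k => ⟨PureIso.restrictFst _ _ _ _⟩
    · exact cls_eq_of_iso (Equiv.refl _) fun k =>
        ⟨PureIso.restrictFst (s := (s k.1)ᶜ) _ _ _ _⟩
  | ind G H φ hφ Z =>
    rw [map_sub, AddMonoidHom.sub_apply, preMul_of, preMul_of, sub_eq_zero, cls_ofPure_prod,
      cls_ofPure_prod]
    refine Finset.sum_congr rfl fun j _ => ?_
    have hφ' : Function.Injective (φ.prodMap (MonoidHom.id (W.comp j).grp)) :=
      hφ.prodMap Function.injective_id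
    exact (cls_eq_of_pureIso (PureIso.indProd φ hφ Z (W.comp j) hφ')).trans
      (pureCls_ind _ hφ' (Z.prod (W.comp j).var))

/-- The multiplication with the first factor in the Grothendieck group. -/
noncomputable def halfMul : K0fGr →+ FreeAbelianGroup FGrVar →+ K0fGr :=
  QuotientAddGroup.lift relSubgroup preMul
    ((AddSubgroup.closure_le (K := preMul.ker)).2 fun _ ha => preMul_rel ha)

/-- The multiplication of the Grothendieck ring, as a biadditive map. -/
noncomputable def mulHom : K0fGr →+ K0fGr →+ K0fGr :=
  QuotientAddGroup.lift relSubgroup halfMul.flip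
    ((AddSubgroup.closure_le (K := halfMul.flip.ker)).2 fun a ha => by
      refine AddMonoidHom.ext fun b => ?_
      obtain ⟨b, rfl⟩ := QuotientAddGroup.mk'_surjective relSubgroup b
      change preMul b a = 0
      rw [← preMul_flip, AddMonoidHom.flip_apply, preMul_rel ha, AddMonoidHom.zero_apply])

lemma induction {p : K0fGr → Prop} (h_cls : ∀ X, p (cls X)) (h_zero : p 0)
    (h_neg : ∀ a, p a → p (-a)) (h_add : ∀ a b, p a → p b → p (a + b)) (a : K0fGr) : p a := by
  obtain ⟨a, rfl⟩ := QuotientAddGroup.mk'_surjective relSubgroup a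
  induction a using FreeAbelianGroup.induction_on with
  | zero => exact h_zero
  | of X => exact h_cls X
  | neg X h => exact h_neg _ h
  | add a b ha hb => exact h_add _ _ ha hb

/-- The product of classes is the class of the Cartesian product. -/
noncomputable instance : Mul K0fGr := ⟨fun a b => mulHom a b⟩

/-- The unit is the class of the one-point variety with the action of the trivial group. -/
noncomputable def pt : GVar Unit where
  carrier := Unit
  str := QProjStr.discrete Unit
  act := { smul := fun _ x => x, one_smul := fun _ => rfl, mul_smul := fun _ _ _ => rfl }
  regular_smul := fun _ => isRegular_id

noncomputable instance : One K0fGr := ⟨pureCls pt⟩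

lemma cls_mul_cls (X Y : FGrVar) : cls X * cls Y = cls (X.prod Y) := by
  rw [cls_prod_comm, ← preMul_of]
  rfl

lemma one_mul_cls (X : FGrVar) : 1 * cls X = cls X := by
  refine (cls_mul_cls _ X).trans ?_
  refine cls_eq_of_iso (Equiv.punitProd _).symm fun k => ⟨(MulEquiv.uniqueProd : Unit × (X.comp k).grp ≃* _), Equiv.punitProd _,
    isRegular_snd, (isRegular_const ()).prodMk isRegular_id, fun _ _ => rfl⟩

noncomputable instance : CommRing K0fGr :=
  have hadd : ∀ a b c : K0fGr, (a + b) * c = a * c + b * c := fun a b c =>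
    DFunLike.congr_fun (map_add mulHom a b) c
  have hadd' : ∀ a b c : K0fGr, a * (b + c) = a * b + a * c := fun a b c =>
    map_add (mulHom a) b c
  have hzero : ∀ a : K0fGr, 0 * a = 0 := fun a => DFunLike.congr_fun (map_zero mulHom) a
  have hzero' : ∀ a : K0fGr, a * 0 = 0 := fun a => map_zero (mulHom a)
  have hneg : ∀ a b : K0fGr, -a * b = -(a * b) := fun a b =>
    DFunLike.congr_fun (map_neg mulHom a) b
  have hneg' : ∀ a b : K0fGr, a * -b = -(a * b) := fun a b => map_neg (mulHom a) b
  have hcomm : ∀ a b : K0fGr, a * b = b * a := fun a b => by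
    induction a using induction with
    | h_cls X =>
      induction b using induction with
      | h_cls Y => rw [cls_mul_cls, cls_mul_cls, cls_prod_comm]
      | h_zero => rw [hzero, hzero']
      | h_neg b hb => rw [hneg, hneg', hb]
      | h_add b c hb hc => rw [hadd, hadd', hb, hc]
    | h_zero => rw [hzero, hzero']
    | h_neg a ha => rw [hneg, hneg', ha]
    | h_add a c ha hc => rw [hadd, hadd', ha, hc]
  have hassoc : ∀ a b c : K0fGr, a * b * c = a * (b * c) := fun a b c => by
    induction a using induction with
    | h_cls X =>
      induction b using induction with
      | h_cls Y =>
        induction c using induction with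
        | h_cls Z => rw [cls_mul_cls, cls_mul_cls, cls_mul_cls, cls_mul_cls, cls_prod_assoc]
        | h_zero => rw [hzero', hzero', hzero']
        | h_neg c hc => rw [hneg', hneg', hneg', hc]
        | h_add c d hc hd => rw [hadd', hadd', hadd', hc, hd]
      | h_zero => rw [hzero, hzero', hzero]
      | h_neg b hb => rw [hneg', hneg, hneg, hneg', hb]
      | h_add b d hb hd => rw [hadd', hadd, hadd, hadd', hb, hd]
    | h_zero => rw [hzero, hzero, hzero]
    | h_neg a ha => rw [hneg, hneg, hneg, ha]
    | h_add a d ha hd => rw [hadd, hadd, hadd, ha, hd]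
  have hone : ∀ a : K0fGr, 1 * a = a := fun a => by
    induction a using induction with
    | h_cls X => exact one_mul_cls X
    | h_zero => exact hzero' 1
    | h_neg a ha => rw [hneg', ha]
    | h_add a b ha hb => rw [hadd', ha, hb]
  { (inferInstance : AddCommGroup K0fGr) with
    mul := (· * ·)
    one := 1
    left_distrib := hadd'
    right_distrib := hadd
    zero_mul := hzero
    mul_zero := hzero'
    mul_assoc := hassoc
    one_mul := hone
    mul_one := fun a => (hcomm a 1).trans (hone a)
    mul_comm := hcomm }

end K0fGr

/-! ### λ-structures and the Kapranov zeta function -/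

open PowerSeries in
/-- A λ-structure on a commutative ring `R`: a map `a ↦ λ_a(t)` from `R` to `1 + t R⟦t⟧` with
`λ_{a+b}(t) = λ_a(t) λ_b(t)` and `λ_a(t) = 1 + a t + ⋯`. -/
structure IsLambdaStructure {R : Type*} [CommRing R] (lam : R → R⟦X⟧) : Prop where
  coeff_zero : ∀ a, coeff 0 (lam a) = 1
  coeff_one : ∀ a, coeff 1 (lam a) = a
  map_add : ∀ a b, lam (a + b) = lam a * lam b

/-- The Kapranov zeta function `ζ_{(Z,G)}(t) = 1 + ∑_{n ≥ 1} [(Zⁿ, Gₙ)] tⁿ`. -/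
noncomputable def kapranovZeta {G : Type} [Group G] [Finite G] (Z : GVar G) : PowerSeries K0fGr :=
  PowerSeries.mk fun n => if n = 0 then 1 else K0fGr.pureCls (Z.pow n)

end FGr

namespace FGr

/-! ### Locality of regularity -/

/-! Everything rests on recognising induced varieties. Suppose that an `H`-variety `W` contains an
open set `s` identified with a `G`-variety `Z` compatibly with an embedding `φ : G → H`, that the
translates of `s` cover `W`, and that an element of `H` taking some point of `s` back into `s` must
lie in `φ(G)`. Then `(h, z) ↦ h z` identifies `ind_G^H Z` with `W`, and the induction relation gives
`[W] = [Z]` (`K0fGr.pureCls_eq_of_slice`). This is applied twice.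

For (i), the tuples in `(ind_G^H Z)ⁿ` with all components in the standard copy of `Z` form such a
slice for `Gₙ → Hₙ`, so `(ind_G^H Z)ⁿ` and `Zⁿ` have the same class (`kapranovZeta_ind`).

For a closed invariant `Y ⊆ Z`, stratify `Zⁿ` by the number `k` of components lying in `Y`. The
points of the `k`-th stratum whose components in `Y` are the first `k` form a slice for `Gₖ × Gₗ →
Gₙ`, where `k + l = n`, and this slice is `Yᵏ × (Z \ Y)ˡ` (`pureCls_stratum`). Summing over `k`
gives `ζ_Z = ζ_Y ζ_{Z \ Y}` (`kapranovZeta_closed`). Part (ii) is the case where `Y` is the first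
summand of a disjoint union.

For (iii), multiplicativity for closed subsets extends formally to finite partitions into locally
closed pieces (`prod_of_locallyClosed_partition`), so equivalent varieties have equal products of
zeta functions. Hence all three relations are respected. Series with constant term 1 are units, so
the product of the zeta functions of the components descends to a homomorphism from the Grothendieck
group to the units of the power series ring (`K0fGr.zetaHom`). Its linear coefficient is additive
and is the identity on the classes of pure actions, because `G₁ = G` acting on `Z¹ = Z`. These
classes generate the group, which yields both the λ-structure and its uniqueness. -/

lemma QProjStr.IsOpen.isLocallyClosed {A : Type} {S : QProjStr A} {s : Set A}
    (h : S.IsOpen s) : S.IsLocallyClosed s :=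
  let _ := S.top
  _root_.IsOpen.isLocallyClosed h

/-- A subvariety keeps the projective embedding, so the topology may be induced in two stages. Hence
an open set of the subvariety is the trace of an open set of the ambient variety. -/
lemma QProjStr.top_restrict {A : Type} (S : QProjStr A) {s : Set A} (hs : S.IsLocallyClosed s) :
    (S.restrict s hs).top = S.top.induced Subtype.val :=
  (induced_compose (tγ := zariski S.σ) (f := (Subtype.val : s → A)) (g := S.emb)).symm

/-- A map which is regular on the members of an open cover is regular. -/
lemma isRegular_of_open_cover {A B : Type} {S : QProjStr A} {T : QProjStr B} {f : A → B}
    (h : ∀ a, ∃ (U : Set A) (hU : S.IsOpen U), a ∈ U ∧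
      IsRegular (S.restrict U hU.isLocallyClosed) T (fun b => f b)) : IsRegular S T f := by
  intro a
  obtain ⟨U, hU, haU, hf⟩ := h a
  obtain ⟨V, hV, haV, d, F, hF, k⟩ := hf ⟨a, haU⟩
  rw [QProjStr.IsOpen, QProjStr.top_restrict] at hV
  obtain ⟨V', hV', rfl⟩ := hV
  exact ⟨U ∩ V', QProjStr.isOpen_inter hU hV', ⟨haU, haV⟩, d, F, hF,
    fun b hb v hv => k ⟨b, hb.1⟩ hb.2 v hv⟩

/-! ### Recognition of induced varieties -/

/-- A slice of a `G`-action of a finite group: an invariant open subset of an `H`-variety whose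
translates cover the variety, and which meets its translates only along the subgroup `φ(G)`,
determines the class of the variety. -/
lemma K0fGr.pureCls_eq_of_slice {G H : Type} [Group G] [Finite G] [Group H] [Finite H]
    (φ : G →* H) (hφ : Function.Injective φ) (Z : GVar G) (W : GVar H) (s : Set W.carrier)
    (hs : W.str.IsOpen s) (r : Z.carrier ≃ s)
    (hr : IsRegular Z.str W.str (fun z => (r z : W.carrier)))
    (hr' : IsRegular (W.str.restrict s hs.isLocallyClosed) Z.str r.symm)
    (hequiv : ∀ g z, (r (g • z) : W.carrier) = φ g • (r z : W.carrier))
    (hcover : ∀ w, ∃ h : H, h • w ∈ s)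
    (hsep : ∀ (h : H), ∀ w ∈ s, h • w ∈ s → h ∈ φ.range) : pureCls W = pureCls Z := by
  let ψ : IndSpace φ Z → W.carrier := IndSpace.lift (fun h z => h • (r z : W.carrier))
    -- Compatibility with the relation: `h φ(g)⁻¹` applied to `r (g x) = φ(g) r x` is `h r x`.
    (fun h g x => by rw [hequiv, smul_smul, inv_mul_cancel_right])
  have hψ : ∀ h z, ψ (IndSpace.mk φ Z h z) = h • (r z : W.carrier) := fun _ _ => rfl
  have hbij : Function.Bijective ψ := by
    constructor
    · refine IndSpace.ind fun h x => IndSpace.ind fun k y hxy => ?_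
      rw [hψ, hψ] at hxy
      have hxy' : (r y : W.carrier) = (k⁻¹ * h) • (r x : W.carrier) := by
        rw [mul_smul, hxy, inv_smul_smul]
      -- If `h r(x) = k r(y)`, then `k⁻¹ h` takes a point of the slice into the slice, so it is some
      -- `φ g`; this `g` relates the two representatives.
      obtain ⟨g, hg⟩ := hsep (k⁻¹ * h) (r x) (r x).2 (hxy' ▸ (r y).2)
      refine IndSpace.mk_eq_iff.2 ⟨g, by rw [hg]; group, r.injective (Subtype.ext ?_)⟩
      rw [hequiv, hg, hxy']
    · intro w
      obtain ⟨h, hw⟩ := hcover w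
      exact ⟨IndSpace.mk φ Z h⁻¹ (r.symm ⟨_, hw⟩), by
        rw [hψ, Equiv.apply_symm_apply, inv_smul_smul]⟩
  rw [← pureCls_ind φ hφ Z]
  refine cls_eq_of_pureIso (PureIso.symm (P := ⟨H, Z.ind φ hφ⟩) (Q := ⟨H, W⟩)
    ⟨MulEquiv.refl _, Equiv.ofBijective ψ hbij, ?_, ?_, ?_⟩)
  · exact isRegular_of_ind fun h => (W.regular_smul h).comp hr
  · refine isRegular_of_open_cover fun w => ?_
    obtain ⟨h, hw⟩ := hcover w
    -- On the open translate `h⁻¹ s` the inverse of `ψ` is `w' ↦ [h⁻¹, r⁻¹ (h w')]`, a composition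
    -- of regular maps.
    have hU : W.str.IsOpen {w' | h • w' ∈ s} := (W.regular_smul h).isOpen_preimage hs
    refine ⟨_, hU, hw, isRegular_of_eq ((isRegular_ind_mk φ hφ Z h⁻¹).comp (hr'.comp
      (((W.regular_smul h).comp (isRegular_val hU.isLocallyClosed)).codRestrict
        hs.isLocallyClosed fun b => b.2))) fun b => ?_⟩
    refine (Equiv.symm_apply_eq _).2 ?_
    refine Eq.trans ?_ (hψ h⁻¹ _).symm
    exact ((congrArg (fun y : s => h⁻¹ • (y : W.carrier)) (r.apply_symm_apply ⟨h • b.1, b.2⟩)).trans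
      (inv_smul_smul h b.1)).symm
  · intro h
    refine IndSpace.ind fun k x => ?_
    exact mul_smul h k (r x : W.carrier)

/-! ### Wreath products -/

section wreath
variable {G H : Type} [Group G] [Group H]

lemma GVar.pow_smul_apply {Z : GVar G} {n : ℕ} (g : Wreath G n) (x : (Z.pow n).carrier)
    (i : Fin n) : (g • x : (Z.pow n).carrier) i = g.left i • x (g.right⁻¹ i) := rfl

/-- The homomorphism of wreath products induced by a homomorphism of groups. -/
def Wreath.map (φ : G →* H) (n : ℕ) : Wreath G n →* Wreath H n :=
  MonoidHom.mk' (fun g => ⟨fun i => φ (g.left i), g.right⟩) fun _ _ =>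
    SemidirectProduct.ext (funext fun _ => map_mul φ _ _) rfl

lemma Wreath.map_injective {φ : G →* H} (hφ : Function.Injective φ) (n : ℕ) :
    Function.Injective (Wreath.map φ n) := fun _ _ h =>
  SemidirectProduct.ext
    (funext fun i => hφ (congrFun (congrArg SemidirectProduct.left h) i))
    (congrArg SemidirectProduct.right h :)

/-- The isomorphism of wreath products induced by an isomorphism of groups. -/
def Wreath.congr (e : G ≃* H) (n : ℕ) : Wreath G n ≃* Wreath H n where
  toFun := Wreath.map e.toMonoidHom n
  invFun := Wreath.map e.symm.toMonoidHom n
  left_inv g := SemidirectProduct.ext (funext fun i => e.symm_apply_apply (g.left i)) rfl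
  right_inv g := SemidirectProduct.ext (funext fun i => e.apply_symm_apply (g.left i)) rfl
  map_mul' := map_mul _

/-- The embedding `Gₖ × Gₗ → Gₙ` for `n = k + l`. -/
def Wreath.sum (G : Type) [Group G] {k l n : ℕ} (e : Fin k ⊕ Fin l ≃ Fin n) :
    Wreath G k × Wreath G l →* Wreath G n :=
  MonoidHom.mk' (fun g => ⟨fun i => Sum.elim g.1.left g.2.left (e.symm i),
    e.permCongr (Equiv.sumCongr g.1.right g.2.right)⟩) fun g h => by
      refine SemidirectProduct.ext (funext fun i => ?_) (Equiv.ext fun i => ?_)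
      · obtain ⟨i | i, rfl⟩ := e.surjective i
        -- The semidirect product evaluates the second factor at the index moved by `g.right⁻¹`.
        -- Spelled out through `e`, this is a sum of two permutations, which does not mix the
        -- blocks.
        · change _ = _ * Sum.elim h.1.left h.2.left
            (e.symm (e ((Equiv.sumCongr g.1.right g.2.right).symm (e.symm (e (Sum.inl i))))))
          simp
          rfl
        · change _ = _ * Sum.elim h.1.left h.2.left
            (e.symm (e ((Equiv.sumCongr g.1.right g.2.right).symm (e.symm (e (Sum.inr i))))))
          simp
          rfl
      · obtain ⟨i | i, rfl⟩ := e.surjective i <;> simp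

/-- Since `n = k + l` is only a propositional equality, indices are always written as `e i` with `i`
in one of the two blocks. This formula and the next two compute the block embedding in that form. -/
lemma Wreath.sum_left {k l n : ℕ} (e : Fin k ⊕ Fin l ≃ Fin n) (g : Wreath G k × Wreath G l)
    (i : Fin k ⊕ Fin l) : (Wreath.sum G e g).left (e i) = Sum.elim g.1.left g.2.left i :=
  congrArg _ (e.symm_apply_apply i)

lemma Wreath.sum_right {k l n : ℕ} (e : Fin k ⊕ Fin l ≃ Fin n) (g : Wreath G k × Wreath G l)
    (i : Fin k ⊕ Fin l) :
    (Wreath.sum G e g).right (e i) = e (Equiv.sumCongr g.1.right g.2.right i) :=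
  congrArg (fun i => e (Equiv.sumCongr g.1.right g.2.right i)) (e.symm_apply_apply i)

lemma Wreath.sum_right_inv {k l n : ℕ} (e : Fin k ⊕ Fin l ≃ Fin n) (g : Wreath G k × Wreath G l)
    (i : Fin k ⊕ Fin l) : (Wreath.sum G e g).right⁻¹ (e i) =
      e ((Equiv.sumCongr g.1.right g.2.right).symm i) := by
  rw [Equiv.Perm.inv_eq_iff_eq, Wreath.sum_right, Equiv.apply_symm_apply]

lemma Wreath.sum_injective {k l n : ℕ} (e : Fin k ⊕ Fin l ≃ Fin n) :
    Function.Injective (Wreath.sum G e) := by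
  intro g h hgh
  have h1 := fun i => (Wreath.sum_left e g i).symm.trans (hgh ▸ Wreath.sum_left e h i)
  have h2 := fun i => e.injective
    ((Wreath.sum_right e g i).symm.trans (hgh ▸ Wreath.sum_right e h i))
  exact Prod.ext
    (SemidirectProduct.ext (funext fun i => h1 (Sum.inl i))
      (Equiv.ext fun i => Sum.inl_injective (h2 (Sum.inl i))))
    (SemidirectProduct.ext (funext fun i => h1 (Sum.inr i))
      (Equiv.ext fun i => Sum.inr_injective (h2 (Sum.inr i))))

/-- A permutation of a finite set that maps one block into itself also preserves the other block, so
it is a sum of two permutations; the component in `Gⁿ` splits without any condition. This supplies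
the separation hypothesis for slices of strata. -/
lemma Wreath.mem_range_sum {k l n : ℕ} (e : Fin k ⊕ Fin l ≃ Fin n) (g : Wreath G n)
    (h : ∀ a : Fin k, ∃ b : Fin k, g.right (e (Sum.inl a)) = e (Sum.inl b)) :
    g ∈ (Wreath.sum G e).range := by
  have hm : e.symm.permCongr g.right ∈ (Equiv.Perm.sumCongrHom (Fin k) (Fin l)).range := by
    refine Equiv.Perm.mem_sumCongrHom_range_of_perm_mapsTo_inl ?_
    rintro _ ⟨a, rfl⟩
    obtain ⟨b, hb⟩ := h a
    exact ⟨b, by simp [hb]⟩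
  obtain ⟨⟨σ, τ⟩, hστ⟩ := hm
  refine ⟨(⟨fun a => g.left (e (Sum.inl a)), σ⟩, ⟨fun b => g.left (e (Sum.inr b)), τ⟩), ?_⟩
  refine SemidirectProduct.ext (funext fun i => ?_) (Equiv.ext fun i => ?_)
  · obtain ⟨i | i, rfl⟩ := e.surjective i <;> rw [Wreath.sum_left] <;> rfl
  · obtain ⟨i, rfl⟩ := e.surjective i
    have := DFunLike.congr_fun hστ i
    rw [Wreath.sum_right]
    exact (congrArg e this).trans (by simp)

end wreath

/-! ### Powers -/

/-- The powers of isomorphic varieties are isomorphic. -/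
noncomputable def PureIso.pow {P Q : PureVar} (e : PureIso P Q) (n : ℕ) :
    PureIso ⟨Wreath P.grp n, P.var.pow n⟩ ⟨Wreath Q.grp n, Q.var.pow n⟩ where
  φ := Wreath.congr e.φ n
  ψ := Equiv.piCongrRight fun _ => e.ψ
  regular := isRegular_pow n fun i => e.regular.comp (isRegular_pow_apply n i)
  regular_symm := isRegular_pow n fun i => e.regular_symm.comp (isRegular_pow_apply n i)
  equivariant := fun g x => funext fun i => e.equivariant (g.left i) (x (g.right⁻¹ i))

/-- The zeroth power is a point. -/
lemma K0fGr.pureCls_pow_zero {G : Type} [Group G] [Finite G] (Z : GVar G) :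
    pureCls (Z.pow 0) = 1 := by
  have : Subsingleton (Wreath G 0) :=
    ⟨fun a b => SemidirectProduct.ext (Subsingleton.elim _ _) (Subsingleton.elim _ _)⟩
  have : Unique (Wreath G 0) := ⟨⟨1⟩, fun _ => Subsingleton.elim _ _⟩
  exact cls_eq_of_pureIso (P := ⟨Wreath G 0, Z.pow 0⟩) (Q := ⟨Unit, pt⟩)
    ⟨MulEquiv.ofUnique, ⟨fun _ => (), fun _ => Fin.elim0, fun _ => funext fun i => i.elim0,
      fun _ => rfl⟩, isRegular_const _, isRegular_const _, fun _ _ => rfl⟩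

/-- The first power is the variety itself. -/
lemma K0fGr.pureCls_pow_one {G : Type} [Group G] [Finite G] (Z : GVar G) :
    pureCls (Z.pow 1) = pureCls Z := by
  -- Since `S₁` is trivial, `g ↦ g.left 0` is an isomorphism of `G₁` with `G`.
  refine cls_eq_of_pureIso (P := ⟨Wreath G 1, Z.pow 1⟩) (Q := ⟨G, Z⟩)
    ⟨⟨⟨fun g => g.left 0, fun g => ⟨fun _ => g, 1⟩, fun g => ?_, fun _ => rfl⟩, fun g h => ?_⟩,
      ⟨fun x => x 0, fun x _ => x, fun x => ?_, fun _ => rfl⟩, isRegular_pow_apply 1 0,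
      isRegular_pow 1 fun _ => isRegular_id, fun g x => ?_⟩
  · exact SemidirectProduct.ext (funext fun i => congrArg g.left (Subsingleton.elim _ _))
      (Subsingleton.elim _ _)
  · exact congrArg (g.left 0 * h.left ·) (Subsingleton.elim _ _)
  · exact funext fun i => congrArg x (Subsingleton.elim _ _)
  · exact congrArg (g.left 0 • x ·) (Subsingleton.elim _ _)

/-! ### The standard copy of `Z` in an induced variety. -/

section coset
variable {G H : Type} [Group G] [Group H]

/-- The coset of `φ(G)` that contains a point of the induced variety. -/
def IndSpace.coset (φ : G →* H) (Z : GVar G) : IndSpace φ Z → H ⧸ φ.range :=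
  IndSpace.lift (fun h _ => (h : H ⧸ φ.range)) fun h g x =>
    (QuotientGroup.eq.2 ⟨g, by simp⟩ : ((h * (φ g)⁻¹ : H) : H ⧸ φ.range) = (h : H ⧸ φ.range))

/-- The fibre of `IndSpace.coset` over the trivial coset is the standard copy of `Z`: when `k` lies
in `φ(G)`, it can be absorbed into the second component of `[k, x]`. -/
lemma IndSpace.exists_mk_one_eq {φ : G →* H} {Z : GVar G} {a : IndSpace φ Z}
    (h : IndSpace.coset φ Z a = (1 : H)) : ∃ x, IndSpace.mk φ Z 1 x = a := by
  induction a using IndSpace.ind with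
  | h k x =>
    obtain ⟨g, hg⟩ := QuotientGroup.eq.1 (h : (k : H ⧸ φ.range) = (1 : H))
    refine ⟨g⁻¹ • x, ?_⟩
    rw [IndSpace.mk_smul, map_inv, hg]
    simp

variable [Finite H]

/-- There is a regular retraction of the induced variety to its standard piece. -/
lemma IndSpace.exists_retraction (φ : G →* H) (hφ : Function.Injective φ) (Z : GVar G) :
    ∃ r : IndSpace φ Z → Z.carrier, IsRegular (indStr φ hφ Z) Z.str r ∧
      ∀ x, r (IndSpace.mk φ Z 1 x) = x := by
  -- The representative chosen in the trivial coset need not be 1; it is some `φ g`. Acting by this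
  -- `g` after the projection to `Z` corrects the choice. Values on the other cosets play no role.
  obtain ⟨g, hg⟩ : ((1 : H) : H ⧸ φ.range).out ∈ φ.range := by
    have h1 : (QuotientGroup.mk (((1 : H) : H ⧸ φ.range).out) : H ⧸ φ.range) = (1 : H) :=
      QuotientGroup.out_eq' _
    simpa using QuotientGroup.eq.1 h1
  refine ⟨fun a => g • ((indEquiv φ hφ Z).symm a).2,
    (Z.regular_smul g).comp (isRegular_snd.comp (isRegular_transport _)), fun x => ?_⟩
  have : (indEquiv φ hφ Z).symm (IndSpace.mk φ Z 1 x) = (((1 : H) : H ⧸ φ.range), g⁻¹ • x) := by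
    rw [Equiv.symm_apply_eq]
    change _ = IndSpace.mk φ Z _ (g⁻¹ • x)
    rw [IndSpace.mk_smul, ← hg, map_inv, mul_inv_cancel]
  simp only [this, smul_inv_smul]

end coset

/-! ### Coefficients of the zeta function and invariance under induction. -/

section zeta
variable {G H : Type} [Group G] [Finite G] [Group H] [Finite H]

/-- The constant term needs no separate treatment: `Z⁰` is a point and `G₀` is trivial. -/
lemma coeff_kapranovZeta (Z : GVar G) (n : ℕ) :
    PowerSeries.coeff n (kapranovZeta Z) = K0fGr.pureCls (Z.pow n) := by
  rw [kapranovZeta, PowerSeries.coeff_mk]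
  split_ifs with h
  · subst h
    exact (K0fGr.pureCls_pow_zero Z).symm
  · rfl

lemma kapranovZeta_eq_of_pureIso {P Q : PureVar} (e : PureIso P Q) :
    kapranovZeta P.var = kapranovZeta Q.var :=
  PowerSeries.ext fun n => by
    rw [coeff_kapranovZeta, coeff_kapranovZeta]
    exact K0fGr.cls_eq_of_pureIso (e.pow n)

/-- The Kapranov zeta function is invariant under induction. -/
theorem kapranovZeta_ind (φ : G →* H) (hφ : Function.Injective φ) (Z : GVar G) :
    kapranovZeta (Z.ind φ hφ) = kapranovZeta Z := by
  ext n
  rw [coeff_kapranovZeta, coeff_kapranovZeta]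
  obtain ⟨r, hr, hrmk⟩ := IndSpace.exists_retraction φ hφ Z
  -- The coset is constant on each copy of `Z`, so it is a regular map to a finite discrete variety
  -- and its fibres are open.
  have hκ : IsRegular (indStr φ hφ Z) (QProjStr.discrete (H ⧸ φ.range)) (IndSpace.coset φ Z) :=
    isRegular_of_ind fun h => isRegular_const (h : H ⧸ φ.range)
  have hmk : ∀ a, IndSpace.coset φ Z a = (1 : H) → IndSpace.mk φ Z 1 (r a) = a := by
    intro a ha
    obtain ⟨x, rfl⟩ := IndSpace.exists_mk_one_eq ha
    rw [hrmk]
  -- The slice: all components lie in the standard copy of `Z`.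
  let s : Set ((Z.ind φ hφ).pow n).carrier := {x | ∀ i, IndSpace.coset φ Z (x i) = (1 : H)}
  have hs : ((Z.ind φ hφ).pow n).str.IsOpen s := by
    let _ := ((Z.ind φ hφ).pow n).str.top
    have : s = ⋂ i, {x | IndSpace.coset φ Z (x i) = (1 : H)} := by
      ext
      simp [s]
    rw [this]
    exact isOpen_iInter_of_finite fun i =>
      (hκ.comp (isRegular_pow_apply n i)).isOpen_preimage (isOpen_discrete {_})
  refine K0fGr.pureCls_eq_of_slice (Wreath.map φ n) (Wreath.map_injective hφ n) (Z.pow n)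
    ((Z.ind φ hφ).pow n) s hs
    ⟨fun x => ⟨fun i => IndSpace.mk φ Z 1 (x i), fun i => rfl⟩, fun x i => r (x.1 i),
      fun x => funext fun i => hrmk _, fun x => Subtype.ext (funext fun i => hmk _ (x.2 i))⟩
    ?_ ?_ ?_ ?_ ?_
  · exact isRegular_pow n fun i => (isRegular_ind_mk φ hφ Z 1).comp (isRegular_pow_apply n i)
  · exact isRegular_pow n fun i => hr.comp
      ((isRegular_pow_apply n i).comp (isRegular_val hs.isLocallyClosed))
  · intro g x
    funext i
    change IndSpace.mk φ Z 1 (g.left i • x (g.right⁻¹ i)) =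
      IndSpace.mk φ Z (φ (g.left i) * 1) (x (g.right⁻¹ i))
    rw [IndSpace.mk_smul, one_mul, mul_one]
  -- Covering: an element of `Hⁿ` with trivial permutation moves each component separately into the
  -- standard copy.
  · intro x
    choose h z hz using fun i => (IndSpace.ind (p := fun a => ∃ h z, a = IndSpace.mk φ Z h z)
      (fun h z => ⟨h, z, rfl⟩) (x i))
    refine ⟨⟨fun i => (h i)⁻¹, 1⟩, fun i => ?_⟩
    have h1 : (h i)⁻¹ • x i = IndSpace.mk φ Z ((h i)⁻¹ * h i) (z i) :=
      congrArg ((h i)⁻¹ • ·) (hz i)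
    rw [inv_mul_cancel] at h1
    exact congrArg (IndSpace.coset φ Z) h1
  -- Separation: each `g.left i` takes a point of the standard copy back into it, hence lies in
  -- `φ(G)`. The permutation is unrestricted, since `Gₙ` and `Hₙ` have the same `Sₙ`.
  · intro g x hx hgx
    have : ∀ i, g.left i ∈ φ.range := by
      intro i
      have h1 := hgx i
      obtain ⟨z, hz⟩ := IndSpace.exists_mk_one_eq (hx (g.right⁻¹ i))
      rw [GVar.pow_smul_apply, ← hz] at h1
      have h2 := QuotientGroup.eq.1
        (h1 : ((g.left i * 1 : H) : H ⧸ φ.range) = (1 : H))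
      simpa using h2
    choose k hk using this
    exact ⟨⟨k, g.right⟩, SemidirectProduct.ext (funext hk) rfl⟩

end zeta

/-! ### Additivity of the class of a variety with a pure action -/

section additivity
variable {G K : Type} [Group G] [Finite G] [Group K] [Finite K]

lemma K0fGr.pureCls_mul_pureCls (Z : GVar G) (W : GVar K) :
    pureCls Z * pureCls W = pureCls (Z.prod W) := by
  refine (cls_mul_cls _ _).trans ((cls_ofPure_prod _ _).trans ?_)
  exact Fintype.sum_unique (ι := Unit) _

/-- The class of a variety is the sum of the classes of the pieces of a partition. -/
lemma K0fGr.pureCls_eq_sum {ν : Type} [Fintype ν] (Z : GVar G) (s : ν → Set Z.carrier)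
    (hs : ∀ k, Z.str.IsLocallyClosed (s k)) (hinv : ∀ k, Z.IsInvariant (s k))
    (h : ∀ x, ∃! k, x ∈ s k) :
    pureCls Z = ∑ k, pureCls (Z.restrict (s k) (hs k) (hinv k)) := by
  -- A variety and the disjoint union of the pieces of its partition are equivalent: the same pieces
  -- partition both. This uses the equivalence relation and avoids any closedness of the pieces.
  have : FGrVar.Equivalent (FGrVar.ofPure ⟨G, Z⟩)
      ⟨ν, fun k => ⟨G, Z.restrict (s k) (hs k) (hinv k)⟩⟩ := by
    refine ⟨ν, inferInstance, ⟨fun _ => (), s, hs, hinv, ?_, ?_⟩,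
      ⟨id, fun _ => Set.univ, fun _ => (QProjStr.isClosed_univ _).isLocallyClosed,
        fun _ _ _ _ => trivial, ?_, ?_⟩, fun k => ⟨(PureIso.restrictUniv (fun _ => trivial) _ _).symm⟩⟩
    · rintro ⟨k, x, hx⟩ ⟨l, y, hy⟩ hxy
      cases hxy
      cases (h x).unique hx hy
      rfl
    · rintro ⟨⟨⟩, x⟩
      obtain ⟨k, hk⟩ := (h x).exists
      exact ⟨⟨k, x, hk⟩, rfl⟩
    · rintro ⟨k, x, hx⟩ ⟨l, y, hy⟩ hxy
      cases hxy
      rfl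
    · rintro ⟨i, x⟩
      exact ⟨⟨i, x, trivial⟩, rfl⟩
  exact (cls_eq_of_equivalent this).trans (cls_eq_sum _)

end additivity

/-! ### The strata of a power -/

/-- Used to sort components: combined with a fixed splitting of `Fin n` into blocks, it yields a
permutation taking a given `k`-element set of indices to the first block. -/
lemma exists_sumEquiv {k l n : ℕ} (h : k + l = n) {N : Set (Fin n)} (hN : N.ncard = k) :
    ∃ e : Fin k ⊕ Fin l ≃ Fin n, (∀ a, e (Sum.inl a) ∈ N) ∧ ∀ b, e (Sum.inr b) ∉ N := by
  classical
  have h1 : Nat.card N = k := by rw [Nat.card_coe_set_eq, hN]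
  have h2 : Nat.card (Nᶜ : Set (Fin n)) = l := by
    have := Set.ncard_add_ncard_compl N
    rw [Nat.card_eq_fintype_card, Fintype.card_fin] at this
    rw [Nat.card_coe_set_eq]
    omega
  let e₁ := Finite.equivFinOfCardEq h1
  let e₂ := Finite.equivFinOfCardEq h2
  refine ⟨(Equiv.sumCongr e₁.symm e₂.symm).trans (Equiv.Set.sumCompl N), fun a => ?_, fun b => ?_⟩
  · simp
  · exact (e₂.symm b).2

lemma eq_range_of_sumEquiv {k l n : ℕ} (e : Fin k ⊕ Fin l ≃ Fin n) {N : Set (Fin n)}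
    (h1 : ∀ a, e (Sum.inl a) ∈ N) (h2 : ∀ b, e (Sum.inr b) ∉ N) :
    N = Set.range (fun a => e (Sum.inl a)) := by
  ext i
  obtain ⟨a | b, rfl⟩ := e.surjective i
  · simp [h1]
  · simp [h2]

lemma ncard_range_inl {k l n : ℕ} (e : Fin k ⊕ Fin l ≃ Fin n) :
    (Set.range (fun a => e (Sum.inl a))).ncard = k := by
  have : Function.Injective fun a => e (Sum.inl a) := e.injective.comp Sum.inl_injective
  rw [← Nat.card_coe_set_eq, Nat.card_range_of_injective this, Nat.card_eq_fintype_card,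
    Fintype.card_fin]

section strata
variable {G : Type} [Group G]

/-- The points of `Zⁿ` exactly `k` of whose components lie in `Y`. -/
def GVar.stratum (Z : GVar G) (Y : Set Z.carrier) (n k : ℕ) : Set (Z.pow n).carrier :=
  {x | {i | x i ∈ Y}.ncard = k}

lemma GVar.IsInvariant.smul_mem_iff {Z : GVar G} {Y : Set Z.carrier} (hY : Z.IsInvariant Y) (g : G)
    (x : Z.carrier) : g • x ∈ Y ↔ x ∈ Y :=
  ⟨fun h => by simpa using hY g⁻¹ _ h, hY g x⟩

/-- `Gⁿ` does not change which components lie in `Y`, and `Sₙ` only permutes their indices, so their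
number is preserved. -/
lemma GVar.isInvariant_stratum {Z : GVar G} {Y : Set Z.carrier} (hY : Z.IsInvariant Y) (n k : ℕ) :
    (Z.pow n).IsInvariant (Z.stratum Y n k) := by
  intro g x hx
  have : {i | (g • x : (Z.pow n).carrier) i ∈ Y} = g.right '' {i | x i ∈ Y} := by
    ext i
    rw [Equiv.image_eq_preimage_symm]
    exact hY.smul_mem_iff _ _
  change Set.ncard _ = k
  rw [this, Set.ncard_image_of_injective _ g.right.injective]
  exact hx

/-- At least `k` components lie in `Y` exactly when all components indexed by some set of at least
`k` indices do; this is a finite union of closed conditions. -/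
lemma GVar.isClosed_le_ncard {Z : GVar G} {Y : Set Z.carrier} (hY : Z.str.IsClosed Y) (n k : ℕ) :
    (Z.pow n).str.IsClosed {x | k ≤ {i | x i ∈ Y}.ncard} := by
  let _ := (Z.pow n).str.top
  have : {x : (Z.pow n).carrier | k ≤ {i | x i ∈ Y}.ncard} =
      ⋃ N ∈ {N : Set (Fin n) | k ≤ N.ncard}, ⋂ i ∈ N, {x : (Z.pow n).carrier | x i ∈ Y} := by
    ext x
    simp only [Set.mem_ofPred_eq, Set.mem_iUnion, Set.mem_iInter, exists_prop]
    exact ⟨fun h => ⟨_, h, fun _ => id⟩, fun ⟨N, h, hN⟩ => h.trans (Set.ncard_le_ncard hN)⟩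
  change _root_.IsClosed _
  rw [this]
  exact Set.Finite.isClosed_biUnion (Set.toFinite _) fun N _ => isClosed_biInter fun i _ =>
    (isRegular_pow_apply n i).isClosed_preimage hY

/-- "Exactly `k`" is the difference of the closed conditions "at least `k`" and "at least `k + 1`".
-/
lemma GVar.isLocallyClosed_stratum {Z : GVar G} {Y : Set Z.carrier} (hY : Z.str.IsClosed Y)
    (n k : ℕ) : (Z.pow n).str.IsLocallyClosed (Z.stratum Y n k) := by
  let _ := (Z.pow n).str.top
  have : Z.stratum Y n k =
      {x | k ≤ {i | x i ∈ Y}.ncard} ∩ {x | k + 1 ≤ {i | x i ∈ Y}.ncard}ᶜ := by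
    ext x
    simp only [GVar.stratum, Set.mem_inter_iff, Set.mem_compl_iff, Set.mem_ofPred_eq]
    omega
  rw [this]
  exact (isClosed_le_ncard hY n k).isLocallyClosed.inter
    (isClosed_le_ncard hY n (k + 1)).isLocallyClosed_compl

/-- The stratum of `Zⁿ` where `k` components lie in a closed set `Y` is induced from the
product of the `k`-th power of `Y` and a power of its complement. -/
lemma pureCls_stratum [Finite G] {k l n : ℕ} (h : k + l = n) (Z : GVar G) {Y : Set Z.carrier}
    (hY : Z.str.IsClosed Y) (hinv : Z.IsInvariant Y) :
    K0fGr.pureCls ((Z.pow n).restrict (Z.stratum Y n k) (GVar.isLocallyClosed_stratum hY n k)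
      (GVar.isInvariant_stratum hinv n k)) =
    K0fGr.pureCls ((Z.restrict Y hY.isLocallyClosed hinv).pow k) *
      K0fGr.pureCls ((Z.restrict Yᶜ hY.isLocallyClosed_compl hinv.compl).pow l) := by
  rw [K0fGr.pureCls_mul_pureCls]
  have hl := GVar.isLocallyClosed_stratum hY n k
  let e : Fin k ⊕ Fin l ≃ Fin n := finSumFinEquiv.trans (finCongr h)
  let W := (Z.pow n).restrict (Z.stratum Y n k) hl (GVar.isInvariant_stratum hinv n k)
  have hreg : ∀ i, IsRegular W.str Z.str (fun x => x.1 i) := fun i =>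
    (isRegular_pow_apply n i).comp (isRegular_val hl)
  -- The slice only asks that the last `l` components avoid `Y`, which is visibly open. Inside the
  -- stratum, counting then forces the first `k` components into `Y`.
  let s : Set W.carrier := {x | ∀ b, x.1 (e (Sum.inr b)) ∈ Yᶜ}
  have hs : W.str.IsOpen s := by
    let _ := W.str.top
    have : s = ⋂ b, (fun x : W.carrier => x.1 (e (Sum.inr b))) ⁻¹' Yᶜ := by
      ext
      simp [s]
    rw [this]
    exact isOpen_iInter_of_finite fun b => (hreg _).isOpen_preimage
      (_root_.IsClosed.isOpen_compl (self := hY))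
  have hrange : ∀ x ∈ s, {i | x.1 i ∈ Y} = Set.range (fun a => e (Sum.inl a)) := by
    intro x hx
    -- The indices of components in `Y` lie in the first block, and both sets have `k` elements.
    refine Set.eq_of_subset_of_ncard_le (fun i hi => ?_) ?_
    · obtain ⟨a | b, rfl⟩ := e.surjective i
      · exact ⟨a, rfl⟩
      · exact (hx b hi).elim
    · rw [ncard_range_inl]
      exact x.2.ge
  have hmem : ∀ x ∈ s, ∀ a, x.1 (e (Sum.inl a)) ∈ Y := fun x hx a =>
    (hrange x hx).ge ⟨a, rfl⟩
  have hsum : ∀ (y : Fin k → Y) (z : Fin l → (Yᶜ : Set Z.carrier)),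
      (fun i => Sum.elim (fun a => (y a : Z.carrier)) (fun b => z b) (e.symm i)) ∈
        Z.stratum Y n k := by
    intro y z
    change Set.ncard _ = k
    refine (congrArg Set.ncard (eq_range_of_sumEquiv e ?_ ?_)).trans (ncard_range_inl e)
    · intro a
      simp
    · intro b
      have : Sum.elim (fun a => (y a : Z.carrier)) (fun b => (z b : Z.carrier))
          (e.symm (e (Sum.inr b))) = z b := by simp
      exact fun hb => (z b).2 (this ▸ hb)
  refine K0fGr.pureCls_eq_of_slice (Wreath.sum G e) (Wreath.sum_injective e) _ W s hs
    ⟨fun p => ⟨⟨_, hsum p.1 p.2⟩, fun b => ?_⟩,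
      fun x => (fun a => ⟨x.1.1 (e (Sum.inl a)), hmem x.1 x.2 a⟩,
        fun b => ⟨x.1.1 (e (Sum.inr b)), x.2 b⟩), fun p => ?_, fun x => ?_⟩ ?_ ?_ ?_ ?_ ?_
  · simpa using (p.2 b).2
  · refine Prod.ext (funext fun a => Subtype.ext ?_) (funext fun b => Subtype.ext ?_)
    · simp
    · simp
  · refine Subtype.ext (Subtype.ext (funext fun i => ?_))
    obtain ⟨a | b, rfl⟩ := e.surjective i <;> simp
  · refine IsRegular.codRestrict (isRegular_pow n fun i => ?_) hl _
    obtain ⟨a | b, rfl⟩ := e.surjective i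
    · exact isRegular_of_eq ((isRegular_val hY.isLocallyClosed).comp
        ((isRegular_pow_apply k a).comp isRegular_fst))
        fun p => congrArg _ (e.symm_apply_apply _)
    · exact isRegular_of_eq ((isRegular_val hY.isLocallyClosed_compl).comp
        ((isRegular_pow_apply l b).comp isRegular_snd))
        fun p => congrArg _ (e.symm_apply_apply _)
  · exact (isRegular_pow k fun a =>
      ((hreg _).comp (isRegular_val _)).codRestrict hY.isLocallyClosed _).prodMk
      (isRegular_pow l fun b =>
        ((hreg _).comp (isRegular_val _)).codRestrict hY.isLocallyClosed_compl _)
  · intro g p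
    refine Subtype.ext (funext fun i => ?_)
    obtain ⟨i, rfl⟩ := e.surjective i
    -- At the index `e i`, the group coefficient and the permuted index are replaced together by
    -- their block forms; each block can then be checked by definition.
    refine Eq.trans ?_ (congrArg₂ (fun (c : G) j => c • Sum.elim (fun a => (p.1 a).1)
      (fun b => (p.2 b).1) (e.symm j)) (Wreath.sum_left e g i)
      (Wreath.sum_right_inv e g i)).symm
    refine (congrArg (Sum.elim _ _) (e.symm_apply_apply i)).trans ?_
    rw [e.symm_apply_apply]
    cases i <;> rfl
  · intro w
    -- Covering: a pure permutation sends the indices of the components in `Y` to the first block.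
    obtain ⟨e', -, he'⟩ := exists_sumEquiv h w.2
    refine ⟨⟨1, e'.symm.trans e⟩, fun b => ?_⟩
    change (1 : G) • w.1 ((e'.symm.trans e).symm (e (Sum.inr b))) ∉ Y
    rw [one_smul]
    simpa using he' b
  · intro g w hw hgw
    refine Wreath.mem_range_sum e g fun a => ?_
    -- Separation: for both `w` and `g w` the components in `Y` are exactly those of the first
    -- block, so `g.right` preserves this block.
    have h1 : g.right (e (Sum.inl a)) ∈ {i | (g • w : W.carrier).1 i ∈ Y} := by
      change g.left _ • w.1 (g.right.symm (g.right (e (Sum.inl a)))) ∈ Y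
      rw [hinv.smul_mem_iff, Equiv.symm_apply_apply]
      exact hmem w hw a
    rw [hrange _ hgw] at h1
    obtain ⟨b, hb⟩ := h1
    exact ⟨b, hb.symm⟩

/-- The Kapranov zeta function is multiplicative with respect to closed subvarieties. -/
theorem kapranovZeta_closed [Finite G] (Z : GVar G) {Y : Set Z.carrier}
    (hY : Z.str.IsClosed Y) (hinv : Z.IsInvariant Y) :
    kapranovZeta Z = kapranovZeta (Z.restrict Y hY.isLocallyClosed hinv) *
      kapranovZeta (Z.restrict Yᶜ hY.isLocallyClosed_compl hinv.compl) := by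
  ext n
  rw [coeff_kapranovZeta, PowerSeries.coeff_mul]
  set f : ℕ × ℕ → K0fGr := fun p =>
    PowerSeries.coeff p.1 (kapranovZeta (Z.restrict Y hY.isLocallyClosed hinv)) *
    PowerSeries.coeff p.2 (kapranovZeta (Z.restrict Yᶜ hY.isLocallyClosed_compl hinv.compl))
  have hf : ∀ p : Finset.HasAntidiagonal.antidiagonal n,
      K0fGr.pureCls ((Z.pow n).restrict (Z.stratum Y n p.1.1)
        (GVar.isLocallyClosed_stratum hY n p.1.1) (GVar.isInvariant_stratum hinv n p.1.1)) =
      f p := by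
    intro p
    rw [pureCls_stratum (Finset.HasAntidiagonal.mem_antidiagonal.1 p.2) Z hY hinv]
    simp only [f, coeff_kapranovZeta]
  clear_value f
  -- The strata are indexed by pairs `(k, l)` with `k + l = n`, so that the sum of their classes is
  -- literally the coefficient of the product of series.
  rw [K0fGr.pureCls_eq_sum (ν := Finset.HasAntidiagonal.antidiagonal n) (Z.pow n) (fun p => Z.stratum Y n p.1.1)
    (fun p => GVar.isLocallyClosed_stratum hY n _) (fun p => GVar.isInvariant_stratum hinv n _)]
  · rw [Finset.sum_congr rfl fun p _ => hf p, Finset.sum_coe_sort _ f]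
  · intro x
    have hx : {i | x i ∈ Y}.ncard ≤ n := by
      simpa using Set.ncard_le_card {i | x i ∈ Y}
    refine ⟨⟨({i | x i ∈ Y}.ncard, n - {i | x i ∈ Y}.ncard), Finset.HasAntidiagonal.mem_antidiagonal.2 ?_⟩, rfl,
      ?_⟩
    · exact Nat.add_sub_cancel' hx
    · rintro ⟨⟨k, l⟩, hkl⟩ (rfl : _ = k)
      rw [Finset.HasAntidiagonal.mem_antidiagonal] at hkl
      refine Subtype.ext (Prod.ext rfl ?_)
      dsimp only at hkl ⊢
      omega

end strata

/-! ### Multiplicative functions on locally closed sets -/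

/-- A function of invariant locally closed sets which is multiplicative with respect to closed
subsets is multiplicative with respect to finite partitions into locally closed sets. -/
lemma prod_of_locallyClosed_partition {X M ν : Type*} [TopologicalSpace X] [CommMonoid M]
    [Fintype ν] (I : Set X → Prop) (hcompl : ∀ s, I s → I sᶜ)
    (hinter : ∀ s t, I s → I t → I (s ∩ t)) (hclosure : ∀ s, I s → I (closure s))
    (F : Set X → M) (hF0 : F ∅ = 1)
    (hF : ∀ A C, IsLocallyClosed A → I A → IsClosed C → I C → F A = F (A ∩ C) * F (A ∩ Cᶜ))
    (s : ν → Set X) (hs : ∀ k, IsLocallyClosed (s k)) (hI : ∀ k, I (s k))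
    (hdisj : Pairwise fun k l => Disjoint (s k) (s l)) {A : Set X} (hA : IsLocallyClosed A)
    (hIA : I A) (hsub : A ⊆ ⋃ k, s k) : F A = ∏ k, F (A ∩ s k) := by
  classical
  -- If the product formula holds for both parts of a cut of `A` by a closed set, it holds for `A`,
  -- since each `A ∩ s k` is cut in the same way.
  have split : ∀ A C, IsLocallyClosed A → I A → IsClosed C → I C →
      F (A ∩ C) = ∏ k, F (A ∩ C ∩ s k) → F (A ∩ Cᶜ) = ∏ k, F (A ∩ Cᶜ ∩ s k) →
      F A = ∏ k, F (A ∩ s k) := by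
    intro A C hA hIA hC hIC h1 h2
    rw [hF A C hA hIA hC hIC, h1, h2, ← Finset.prod_mul_distrib]
    refine Finset.prod_congr rfl fun k _ => ?_
    rw [hF (A ∩ s k) C (hA.inter (hs k)) (hinter _ _ hIA (hI k)) hC hIC,
      Set.inter_right_comm A C, Set.inter_right_comm A Cᶜ]
  have base : ∀ A k, A ⊆ s k → F A = ∏ k, F (A ∩ s k) := by
    intro A k hk
    rw [Finset.prod_eq_single k, Set.inter_eq_left.2 hk]
    · intro l _ hl
      rw [((hdisj hl.symm).mono_left hk).inter_eq, hF0]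
    · exact fun h => (h (Finset.mem_univ k)).elim
  -- Induction on a finite set of pieces that suffices to cover `A`. To remove `s j`, cut `A` by the
  -- closure of `s j` and then by its boundary `closure (s j) \ s j`. One part lies inside `s j`;
  -- the other two avoid it and are covered by the remaining pieces.
  have key : ∀ (T : Finset ν) (A : Set X), IsLocallyClosed A → I A → (A ⊆ ⋃ k ∈ T, s k) →
      F A = ∏ k, F (A ∩ s k) := by
    intro T
    induction T using Finset.induction_on with
    | empty =>
      intro A _ _ h
      have : A = ∅ := by simpa using h
      simp [this, hF0]
    | insert j T _ ih =>
      intro A hA hIA h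
      -- This is where local closedness of the pieces is used.
      have hD : IsClosed (closure (s j) \ s j) := by
        simpa [coborder] using (hs j).isOpen_coborder
      have hID : I (closure (s j) \ s j) := hinter _ _ (hclosure _ (hI j)) (hcompl _ (hI j))
      have hT : ∀ x ∈ A, x ∉ s j → x ∈ ⋃ k ∈ T, s k := by
        intro x hx hxj
        have := h hx
        rw [Finset.set_biUnion_insert] at this
        exact this.resolve_left hxj
      have hA1 := hA.inter (isClosed_closure (s := s j)).isLocallyClosed
      have hI1 := hinter _ _ hIA (hclosure _ (hI j))
      refine split A (closure (s j)) hA hIA isClosed_closure (hclosure _ (hI j)) ?_ ?_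
      · refine split _ _ hA1 hI1 hD hID ?_ ?_
        · exact ih _ (hA1.inter hD.isLocallyClosed) (hinter _ _ hI1 hID)
            fun x hx => hT x hx.1.1 hx.2.2
        · exact base _ j fun x hx => by_contra fun hxj => hx.2 ⟨hx.1.2, hxj⟩
      · exact ih _ (hA.inter isClosed_closure.isOpen_compl.isLocallyClosed)
          (hinter _ _ hIA (hcompl _ (hclosure _ (hI j))))
          fun x hx => hT x hx.1 fun hxj => hx.2 (subset_closure hxj)
  exact key Finset.univ A hA hIA (by simpa using hsub)

/-! ### The zeta functions of the pieces of a variety -/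

section zetaOn
variable {G : Type} [Group G]

lemma GVar.IsInvariant.inter {Z : GVar G} {s t : Set Z.carrier} (hs : Z.IsInvariant s)
    (ht : Z.IsInvariant t) : Z.IsInvariant (s ∩ t) :=
  fun g x hx => ⟨hs g x hx.1, ht g x hx.2⟩

lemma GVar.IsInvariant.closure {Z : GVar G} {s : Set Z.carrier} (hs : Z.IsInvariant s) :
    Z.IsInvariant (@_root_.closure _ Z.str.top s) := by
  let _ := Z.str.top
  exact fun g x hx => map_mem_closure (Z.regular_smul g).continuous hx (hs g)

lemma QProjStr.IsLocallyClosed.inter {A : Type} {S : QProjStr A} {s t : Set A}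
    (hs : S.IsLocallyClosed s) (ht : S.IsLocallyClosed t) : S.IsLocallyClosed (s ∩ t) :=
  let _ := S.top
  _root_.IsLocallyClosed.inter hs ht

variable [Finite G]

/-- An invariant piece of an invariant piece. -/
def PureIso.restrictRestrict (Z : GVar G) {A C : Set Z.carrier} (hA : Z.str.IsLocallyClosed A)
    (hA' : Z.IsInvariant A) (hC : Z.str.IsLocallyClosed C) (hC' : Z.IsInvariant C)
    {D : Set A} (hD : D = Subtype.val ⁻¹' C)
    (hD' : (Z.restrict A hA hA').str.IsLocallyClosed D) (hD'' : (Z.restrict A hA hA').IsInvariant D) :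
    PureIso ⟨G, (Z.restrict A hA hA').restrict D hD' hD''⟩
      ⟨G, Z.restrict (A ∩ C) (hA.inter hC) (hA'.inter hC')⟩ where
  φ := MulEquiv.refl _
  ψ :=
    { toFun := fun x => ⟨x.1.1, x.1.2, hD.le x.2⟩
      invFun := fun x => ⟨⟨x.1, x.2.1⟩, hD.ge x.2.2⟩
      left_inv := fun _ => rfl
      right_inv := fun _ => rfl }
  regular := ((isRegular_val hA).comp (isRegular_val hD')).codRestrict (hA.inter hC) _
  regular_symm := ((isRegular_val (hA.inter hC)).codRestrict hA _).codRestrict hD' _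
  equivariant := fun _ _ => rfl

/-- For `n > 0` the power `Zⁿ` is empty, and the partition with no pieces shows that its class is
the empty sum; only the constant term survives. -/
lemma kapranovZeta_of_isEmpty (Z : GVar G) [IsEmpty Z.carrier] : kapranovZeta Z = 1 := by
  ext n
  rw [coeff_kapranovZeta, PowerSeries.coeff_one]
  split_ifs with h
  · subst h
    exact K0fGr.pureCls_pow_zero Z
  · have : Nonempty (Fin n) := ⟨⟨0, Nat.pos_of_ne_zero h⟩⟩
    have : IsEmpty (Z.pow n).carrier := inferInstanceAs (IsEmpty (Fin n → Z.carrier))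
    rw [K0fGr.pureCls_eq_sum (ν := Empty) (Z.pow n) (fun _ => ∅) (fun k => k.elim)
      (fun k => k.elim) isEmptyElim]
    rfl

open Classical in
/-- The Kapranov zeta function of an invariant locally closed subset. -/
noncomputable def zetaOn (Z : GVar G) (s : Set Z.carrier) : PowerSeries K0fGr :=
  -- The value 1 elsewhere is arbitrary; it makes this a function of all subsets, as
  -- `prod_of_locallyClosed_partition` requires.
  if h : Z.str.IsLocallyClosed s ∧ Z.IsInvariant s then kapranovZeta (Z.restrict s h.1 h.2) else 1

lemma zetaOn_eq (Z : GVar G) {s : Set Z.carrier} (h : Z.str.IsLocallyClosed s)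
    (h' : Z.IsInvariant s) : zetaOn Z s = kapranovZeta (Z.restrict s h h') :=
  dif_pos ⟨h, h'⟩

lemma zetaOn_empty (Z : GVar G) : zetaOn Z ∅ = 1 := by
  rw [zetaOn_eq Z Z.str.isClosed_empty.isLocallyClosed fun _ _ h => h.elim]
  have : IsEmpty (Z.restrict ∅ Z.str.isClosed_empty.isLocallyClosed
    fun _ _ h => h.elim).carrier := inferInstanceAs (IsEmpty (∅ : Set Z.carrier))
  exact kapranovZeta_of_isEmpty _

lemma zetaOn_univ (Z : GVar G) : zetaOn Z Set.univ = kapranovZeta Z := by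
  rw [zetaOn_eq Z Z.str.isClosed_univ.isLocallyClosed fun _ _ _ => trivial]
  exact kapranovZeta_eq_of_pureIso (PureIso.restrictUniv (P := ⟨G, Z⟩)
    (s := Set.univ) (fun _ => trivial) _ fun _ _ _ => trivial)

/-- The trace of `C` on the subvariety `A` is closed, so `kapranovZeta_closed` applies to `A`;
pieces of `A` are then identified with pieces of `Z`. -/
lemma zetaOn_closed (Z : GVar G) {A C : Set Z.carrier} (hA : Z.str.IsLocallyClosed A)
    (hA' : Z.IsInvariant A) (hC : Z.str.IsClosed C) (hC' : Z.IsInvariant C) :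
    zetaOn Z A = zetaOn Z (A ∩ C) * zetaOn Z (A ∩ Cᶜ) := by
  have hD : (Z.restrict A hA hA').str.IsClosed (Subtype.val ⁻¹' C) :=
    (isRegular_val hA).isClosed_preimage hC
  have hD' : (Z.restrict A hA hA').IsInvariant (Subtype.val ⁻¹' C) := fun g x hx => hC' g x.1 hx
  rw [zetaOn_eq Z hA hA', zetaOn_eq Z (hA.inter hC.isLocallyClosed) (hA'.inter hC'),
    zetaOn_eq Z (hA.inter hC.isLocallyClosed_compl) (hA'.inter hC'.compl),
    kapranovZeta_closed _ hD hD']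
  exact congrArg₂ (· * ·)
    (kapranovZeta_eq_of_pureIso
      (PureIso.restrictRestrict Z hA hA' hC.isLocallyClosed hC' rfl _ hD'))
    (kapranovZeta_eq_of_pureIso
      (PureIso.restrictRestrict Z hA hA' hC.isLocallyClosed_compl hC'.compl rfl _ hD'.compl))

/-- The Kapranov zeta function is multiplicative with respect to partitions. -/
lemma kapranovZeta_eq_prod {ν : Type} [Fintype ν] (Z : GVar G) (s : ν → Set Z.carrier)
    (hs : ∀ k, Z.str.IsLocallyClosed (s k)) (hinv : ∀ k, Z.IsInvariant (s k))
    (h : ∀ x, ∃! k, x ∈ s k) : kapranovZeta Z = ∏ k, zetaOn Z (s k) := by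
  let _ := Z.str.top
  rw [← zetaOn_univ, prod_of_locallyClosed_partition Z.IsInvariant
    (fun _ => GVar.IsInvariant.compl) (fun _ _ => GVar.IsInvariant.inter)
    (fun _ => GVar.IsInvariant.closure) (zetaOn Z) (zetaOn_empty Z)
    (fun A C => zetaOn_closed Z) s hs hinv ?_ Z.str.isClosed_univ.isLocallyClosed
    (fun _ _ _ => trivial) ?_]
  · simp
  · exact fun k l hkl => Set.disjoint_left.2 fun x hk hl => hkl ((h x).unique hk hl)
  · exact fun x _ => Set.mem_iUnion.2 (h x).exists

/-- The Kapranov zeta function sends disjoint unions to products. -/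
theorem kapranovZeta_sum (Z₁ Z₂ : GVar G) :
    kapranovZeta (Z₁.sum Z₂) = kapranovZeta Z₁ * kapranovZeta Z₂ := by
  let Y : Set (Z₁.sum Z₂).carrier := Set.range (Sum.inl : Z₁.carrier → Z₁.carrier ⊕ Z₂.carrier)
  have hYc : Yᶜ = Sum.inr '' (Set.univ : Set Z₂.carrier) :=
    Set.compl_range_inl.trans Set.image_univ.symm
  -- The first summand is closed because its complement is the open image of the second.
  have hY : (Z₁.sum Z₂).str.IsClosed Y :=
    let _ := (Z₁.sum Z₂).str.top
    ⟨hYc ▸ isOpen_image_inr Z₂.str.isOpen_univ⟩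
  have hinv : (Z₁.sum Z₂).IsInvariant Y := by
    rintro g _ ⟨x, rfl⟩
    exact ⟨g • x, rfl⟩
  rw [kapranovZeta_closed _ hY hinv]
  have h1 : Function.Bijective (fun x => ⟨Sum.inl x, x, rfl⟩ : Z₁.carrier → Y) := by
    refine ⟨fun x y h => Sum.inl_injective (congrArg Subtype.val h), ?_⟩
    rintro ⟨_, x, rfl⟩
    exact ⟨x, rfl⟩
  have h2 : Function.Bijective (fun x => ⟨Sum.inr x, hYc.ge ⟨x, trivial, rfl⟩⟩ :
      Z₂.carrier → (Yᶜ : Set (Z₁.sum Z₂).carrier)) := by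
    refine ⟨fun x y h => Sum.inr_injective (congrArg Subtype.val h), ?_⟩
    rintro ⟨x | x, hx⟩
    · exact (hx ⟨x, rfl⟩).elim
    · exact ⟨x, rfl⟩
  let e₁ : PureIso ⟨G, Z₁⟩ ⟨G, (Z₁.sum Z₂).restrict Y hY.isLocallyClosed hinv⟩ :=
    { φ := MulEquiv.refl _
      ψ := Equiv.ofBijective _ h1
      regular := isRegular_inl.codRestrict hY.isLocallyClosed _
      -- The inverse of the inclusion forgets the homogeneous coordinates of the other summand, all
      -- of which vanish here.
      regular_symm := isRegular_of_linear Sum.inl fun b v hv => by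
        obtain ⟨x, rfl⟩ := h1.surjective b
        exact (Equiv.ofBijective_symm_apply_apply _ h1 x).symm ▸ (isCoord_of_linl hv).1
      equivariant := fun _ _ => rfl }
  let e₂ : PureIso ⟨G, Z₂⟩ ⟨G, (Z₁.sum Z₂).restrict Yᶜ hY.isLocallyClosed_compl hinv.compl⟩ :=
    { φ := MulEquiv.refl _
      ψ := Equiv.ofBijective _ h2
      regular := isRegular_inr.codRestrict hY.isLocallyClosed_compl _
      regular_symm := isRegular_of_linear Sum.inr fun b v hv => by
        obtain ⟨x, rfl⟩ := h2.surjective b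
        exact (Equiv.ofBijective_symm_apply_apply _ h2 x).symm ▸ (isCoord_of_linr hv).1
      equivariant := fun _ _ => rfl }
  exact congrArg₂ (· * ·) (kapranovZeta_eq_of_pureIso e₁).symm (kapranovZeta_eq_of_pureIso e₂).symm

end zetaOn

/-! ### The zeta function on the Grothendieck ring -/

/-- The product of the zeta functions of the components. -/
noncomputable def zetaProd (X : FGrVar) : PowerSeries K0fGr :=
  ∏ i, kapranovZeta (X.comp i).var

lemma zetaProd_ofPure (P : PureVar) : zetaProd (FGrVar.ofPure P) = kapranovZeta P.var :=
  Fintype.prod_unique (ι := Unit) _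

/-- Each component is partitioned by the pieces it contains, so its zeta function is a product over
them; regrouping gives one factor per piece. -/
lemma zetaProd_eq_of_partition (X : FGrVar) {ν : Type} [Fintype ν] (P : X.Partition ν) :
    zetaProd X = ∏ k, kapranovZeta (P.piece k).var := by
  classical
  -- The trace of the piece `k` on the component `i`: the piece itself if `i = P.idx k`, and empty
  -- otherwise. The equality of dependent pairs avoids transporting sets between components.
  let T : ∀ i, ν → Set (X.comp i).var.carrier := fun i k =>
    {x | ∃ y ∈ P.set k, (⟨P.idx k, y⟩ : Σ i, (X.comp i).var.carrier) = ⟨i, x⟩}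
  have hT : ∀ k, T (P.idx k) k = P.set k := by
    intro k
    ext x
    constructor
    · rintro ⟨y, hy, h⟩
      cases h
      exact hy
    · exact fun hx => ⟨x, hx, rfl⟩
  have hT' : ∀ i k, i ≠ P.idx k → T i k = ∅ := by
    intro i k hik
    refine Set.eq_empty_iff_forall_notMem.2 ?_
    rintro x ⟨y, -, h⟩
    exact hik (congrArg Sigma.fst h).symm
  have hl : ∀ i k, (X.comp i).var.str.IsLocallyClosed (T i k) := by
    intro i k
    by_cases h : i = P.idx k
    · subst h
      rw [hT]
      exact P.isLocallyClosed k
    · rw [hT' i k h]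
      exact (QProjStr.isClosed_empty _).isLocallyClosed
  have hinv : ∀ i k, (X.comp i).var.IsInvariant (T i k) := by
    intro i k
    by_cases h : i = P.idx k
    · subst h
      rw [hT]
      exact P.isInvariant k
    · rw [hT' i k h]
      exact fun _ _ h => h.elim
  have hpart : ∀ i x, ∃! k, x ∈ T i k := by
    intro i x
    obtain ⟨⟨k, y, hy⟩, h⟩ := P.bijective.2 ⟨i, x⟩
    refine ⟨k, ⟨y, hy, h⟩, ?_⟩
    rintro l ⟨z, hz, h'⟩
    exact congrArg Sigma.fst (P.bijective.1 (a₁ := ⟨l, z, hz⟩) (a₂ := ⟨k, y, hy⟩) (h'.trans h.symm))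
  rw [zetaProd, Finset.prod_congr rfl fun i _ =>
    kapranovZeta_eq_prod (X.comp i).var (T i) (hl i) (hinv i) (hpart i), Finset.prod_comm]
  refine Finset.prod_congr rfl fun k _ => ?_
  -- After the exchange of products, only the component containing the piece contributes, because
  -- `zetaOn` is 1 on the empty set.
  rw [Finset.prod_eq_single (P.idx k), hT, zetaOn_eq _ (P.isLocallyClosed k) (P.isInvariant k)]
  · rfl
  · intro i _ hi
    rw [hT' i k hi, zetaOn_empty]
  · exact fun h => (h (Finset.mem_univ _)).elim

lemma zetaProd_eq_of_equivalent {X Y : FGrVar} (h : X.Equivalent Y) : zetaProd X = zetaProd Y := by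
  obtain ⟨ν, _, P, Q, h⟩ := h
  have := Fintype.ofFinite ν
  rw [zetaProd_eq_of_partition X P, zetaProd_eq_of_partition Y Q]
  exact Finset.prod_congr rfl fun k _ => kapranovZeta_eq_of_pureIso (h k).some

lemma constantCoeff_kapranovZeta {G : Type} [Group G] [Finite G] (Z : GVar G) :
    PowerSeries.constantCoeff (kapranovZeta Z) = 1 := by
  rw [← PowerSeries.coeff_zero_eq_constantCoeff_apply, coeff_kapranovZeta, K0fGr.pureCls_pow_zero]

/-- Invertibility provides a target group in which formal differences of varieties have zeta
functions. -/
lemma isUnit_zetaProd (X : FGrVar) : IsUnit (zetaProd X) := by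
  rw [PowerSeries.isUnit_iff_constantCoeff, zetaProd, map_prod]
  simp [constantCoeff_kapranovZeta]

/-- The zeta function on the free abelian group. -/
noncomputable def freeZeta : FreeAbelianGroup FGrVar →+ Additive (PowerSeries K0fGr)ˣ :=
  FreeAbelianGroup.lift fun X => Additive.ofMul (isUnit_zetaProd X).unit

lemma freeZeta_of (X : FGrVar) :
    freeZeta (FreeAbelianGroup.of X) = Additive.ofMul (isUnit_zetaProd X).unit :=
  FreeAbelianGroup.lift_apply_of _ _

/-- The three relations correspond to multiplicativity over partitions, multiplicativity for closed
subvarieties, and invariance under induction. -/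
lemma freeZeta_rel {a : FreeAbelianGroup FGrVar} (ha : Rel a) : freeZeta a = 0 := by
  cases ha with
  | equivalent X Y h =>
    rw [map_sub, sub_eq_zero, freeZeta_of, freeZeta_of]
    exact congrArg Additive.ofMul (Units.ext (zetaProd_eq_of_equivalent h))
  | closed X s hs hinv =>
    rw [map_sub, map_add, sub_eq_zero, freeZeta_of, freeZeta_of, freeZeta_of, ← ofMul_mul]
    refine congrArg Additive.ofMul (Units.ext ?_)
    refine Eq.trans ?_ Finset.prod_mul_distrib
    exact Finset.prod_congr rfl fun i _ => kapranovZeta_closed (X.comp i).var (hs i) (hinv i)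
  | ind G H φ hφ Z =>
    rw [map_sub, sub_eq_zero, freeZeta_of, freeZeta_of]
    refine congrArg Additive.ofMul (Units.ext ?_)
    exact (zetaProd_ofPure _).trans ((kapranovZeta_ind φ hφ Z).trans
      (zetaProd_ofPure ⟨G, Z⟩).symm)

/-! ### Descent to the Grothendieck ring and the λ-structure. -/

namespace K0fGr

/-- The zeta function on the Grothendieck ring. -/
noncomputable def zetaHom : K0fGr →+ Additive (PowerSeries K0fGr)ˣ :=
  QuotientAddGroup.lift relSubgroup freeZeta
    ((AddSubgroup.closure_le (K := freeZeta.ker)).2 fun _ ha => freeZeta_rel ha)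

/-- The λ-structure given by the Kapranov zeta function. -/
noncomputable def kapranovLambda (a : K0fGr) : PowerSeries K0fGr := (zetaHom a).toMul.1

lemma kapranovLambda_cls (X : FGrVar) : kapranovLambda (cls X) = zetaProd X :=
  congrArg (fun u : Additive (PowerSeries K0fGr)ˣ => (u.toMul : PowerSeries K0fGr)) (freeZeta_of X)

lemma kapranovLambda_pureCls {G : Type} [Group G] [Finite G] (Z : GVar G) :
    kapranovLambda (pureCls Z) = kapranovZeta Z :=
  (kapranovLambda_cls _).trans (zetaProd_ofPure _)

lemma kapranovLambda_add (a b : K0fGr) :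
    kapranovLambda (a + b) = kapranovLambda a * kapranovLambda b := by
  rw [kapranovLambda, map_add]
  rfl

lemma kapranovLambda_zero : kapranovLambda 0 = 1 := by
  rw [kapranovLambda, map_zero]
  rfl

/-- The Grothendieck ring is generated by the classes of varieties with pure actions. -/
lemma pure_induction {p : K0fGr → Prop}
    (h_cls : ∀ (G : Type) [Group G] [Finite G] (Z : GVar G), p (pureCls Z)) (h_zero : p 0)
    (h_neg : ∀ a, p a → p (-a)) (h_add : ∀ a b, p a → p b → p (a + b)) (a : K0fGr) : p a := by
  induction a using K0fGr.induction with
  | h_cls X =>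
    rw [cls_eq_sum]
    exact Finset.sum_induction _ p h_add h_zero fun i _ => h_cls _ (X.comp i).var
  | h_zero => exact h_zero
  | h_neg a ha => exact h_neg a ha
  | h_add a b ha hb => exact h_add a b ha hb

end K0fGr

/-- For constant terms 1, the linear coefficient turns products into sums, so the linear term of
`kapranovLambda` is additive and can be computed on generators. -/
lemma coeff_one_mul_of_constantCoeff {R : Type*} [CommRing R] {f g : PowerSeries R}
    (hf : PowerSeries.coeff 0 f = 1) (hg : PowerSeries.coeff 0 g = 1) :
    PowerSeries.coeff 1 (f * g) = PowerSeries.coeff 1 f + PowerSeries.coeff 1 g := by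
  rw [PowerSeries.coeff_mul, Finset.Nat.antidiagonal_succ]
  simp [hf, hg, add_comm]

/-- The Kapranov zeta function defines a λ-structure. -/
theorem isLambdaStructure_kapranovLambda : IsLambdaStructure K0fGr.kapranovLambda := by
  have hmul : ∀ f g : PowerSeries K0fGr, PowerSeries.coeff 0 (f * g) =
      PowerSeries.coeff 0 f * PowerSeries.coeff 0 g := fun f g => by simp
  have h0 : ∀ a, PowerSeries.coeff 0 (K0fGr.kapranovLambda a) = 1 := by
    intro a
    induction a using K0fGr.pure_induction with
    | h_cls G Z =>
      rw [K0fGr.kapranovLambda_pureCls, coeff_kapranovZeta, K0fGr.pureCls_pow_zero]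
    | h_zero => simp [K0fGr.kapranovLambda_zero]
    | h_neg a ha =>
      -- Negatives are handled through `λ_{-a} λ_a = λ_0 = 1`.
      have h := congrArg (PowerSeries.coeff 0) (K0fGr.kapranovLambda_add (-a) a)
      rw [neg_add_cancel, K0fGr.kapranovLambda_zero, hmul, ha] at h
      simpa using h.symm
    | h_add a b ha hb =>
      rw [K0fGr.kapranovLambda_add, hmul, ha, hb, one_mul]
  have hadd : ∀ a b, PowerSeries.coeff 1 (K0fGr.kapranovLambda (a + b)) =
      PowerSeries.coeff 1 (K0fGr.kapranovLambda a) +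
        PowerSeries.coeff 1 (K0fGr.kapranovLambda b) := fun a b => by
    rw [K0fGr.kapranovLambda_add, coeff_one_mul_of_constantCoeff (h0 a) (h0 b)]
  have hzero : PowerSeries.coeff 1 (K0fGr.kapranovLambda 0) = 0 := by
    simpa using hadd 0 0
  refine ⟨h0, fun a => ?_, K0fGr.kapranovLambda_add⟩
  induction a using K0fGr.pure_induction with
  | h_cls G Z =>
    rw [K0fGr.kapranovLambda_pureCls, coeff_kapranovZeta, K0fGr.pureCls_pow_one]
  | h_zero => exact hzero
  | h_neg a ha =>
    have h := hadd (-a) a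
    rw [neg_add_cancel, hzero, ha] at h
    exact eq_neg_of_add_eq_zero_left h.symm
  | h_add a b ha hb => rw [hadd, ha, hb]

/-- A λ-structure is determined by its values on the classes of varieties with pure actions. -/
lemma IsLambdaStructure.ext_of_pureCls {lam mu : K0fGr → PowerSeries K0fGr}
    (hlam : IsLambdaStructure lam) (hmu : IsLambdaStructure mu)
    (h : ∀ (G : Type) [Group G] [Finite G] (Z : GVar G),
      lam (K0fGr.pureCls Z) = mu (K0fGr.pureCls Z)) : lam = mu := by
  -- The constant term 1 makes every value of a λ-structure invertible. Hence `λ_0 = λ_0²` forces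
  -- `λ_0 = 1`, and `λ_{-a}` is determined as the inverse of `λ_a`.
  have hunit : ∀ {f : K0fGr → PowerSeries K0fGr}, IsLambdaStructure f → ∀ a, IsUnit (f a) := by
    intro f hf a
    rw [PowerSeries.isUnit_iff_constantCoeff, ← PowerSeries.coeff_zero_eq_constantCoeff_apply,
      hf.coeff_zero]
    exact isUnit_one
  have hzero : ∀ {f : K0fGr → PowerSeries K0fGr}, IsLambdaStructure f → f 0 = 1 := by
    intro f hf
    have h0 := hf.map_add 0 0
    rw [add_zero] at h0
    exact (hunit hf 0).mul_left_cancel (by rw [← h0, mul_one])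
  funext a
  induction a using K0fGr.pure_induction with
  | h_cls G Z => exact h G Z
  | h_zero => rw [hzero hlam, hzero hmu]
  | h_neg a ha =>
    refine (hunit hlam a).mul_left_cancel ?_
    rw [← hlam.map_add, ha, ← hmu.map_add, add_neg_cancel, hzero hlam, hzero hmu]
  | h_add a b ha hb => rw [hlam.map_add, hmu.map_add, ha, hb]

end FGr

/-- The Kapranov zeta function `ζ_{(Z,G)}(t) = 1 + ∑ [(Zⁿ, Gₙ)] tⁿ` is invariant under induction,
sends disjoint unions to products, and is well defined on the Grothendieck ring
`K₀^{fGr}(Var_ℂ)`, on which it defines a λ-structure. -/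
theorem mainTheorem6 :
    (∀ (G H : Type) [Group G] [Finite G] [Group H] [Finite H] (φ : G →* H)
      (hφ : Function.Injective φ) (Z : FGr.GVar G),
      FGr.kapranovZeta (Z.ind φ hφ) = FGr.kapranovZeta Z) ∧
    (∀ (G : Type) [Group G] [Finite G] (Z₁ Z₂ : FGr.GVar G),
      FGr.kapranovZeta (Z₁.sum Z₂) = FGr.kapranovZeta Z₁ * FGr.kapranovZeta Z₂) ∧
    (∃! lam : FGr.K0fGr → PowerSeries FGr.K0fGr,
      FGr.IsLambdaStructure lam ∧
      ∀ (G : Type) [Group G] [Finite G] (Z : FGr.GVar G),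
        lam (FGr.K0fGr.pureCls Z) = FGr.kapranovZeta Z) := by
  exact ⟨fun _ _ _ _ _ _ φ hφ Z => FGr.kapranovZeta_ind φ hφ Z,
    fun _ _ _ Z₁ Z₂ => FGr.kapranovZeta_sum Z₁ Z₂, FGr.K0fGr.kapranovLambda,
    ⟨FGr.isLambdaStructure_kapranovLambda, fun _ _ _ Z => FGr.K0fGr.kapranovLambda_pureCls Z⟩,
    fun mu hmu => hmu.1.ext_of_pureCls FGr.isLambdaStructure_kapranovLambda fun G _ _ Z =>
      (hmu.2 G Z).trans (FGr.K0fGr.kapranovLambda_pureCls Z).symm⟩
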